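/- Let $S(z)=-\frac{1}{z+1}$ and $T(z)=z+2$, let $\Gamma\subset \operatorname{PSL}(2,\mathbb Z)$ be the group generated by $S$ and $T$, acting on the upper half-plane $\mathbb H$, let $\mathcal M_o=\Gamma\backslash\mathbb H$ with projection $\pi_o:\mathbb H\to\mathcal M_o$, and put $G=\frac{1+\sqrt5}{2}$, $I_G=(G-2,G)$. Geodesics of $\mathbb H$ are complete, oriented and parametrized by arc length; $\gamma_\infty$ and $\gamma_{-\infty}$ denote the forward and backward endpoints of $\gamma$. A geodesic on $\mathcal M_o$ is a curve $\bar\gamma=\pi_o\circ\gamma$ with $\gamma$ a geodesic of $\mathbb H$; every geodesic $\gamma$ of $\mathbb H$ with $\pi_o\circ\gamma=\bar\gamma$ is called a lift of $\bar\gamma$, and $\bar\gamma$ is closed if $\bar\gamma(t+L)=\bar\gamma(t)$ for some $L>0$ and all $t\in\mathbb R$. Let $\mathcal A_o$ be the set of geodesics $\gamma$ of $\mathbb H$ with $$(\gamma_\infty,\gamma_{-\infty})\in\big((1,\infty)\times(-I_G)\big)\cup\big((-\infty,-1)\times I_G\big).$$ For digits $(a_i,\epsilon_i)$ with $a_i$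 an odd positive integer, $\epsilon_i\in\{\pm1\}$ and $a_i+\epsilon_i\geqslant 2$, write (as limits of the finite truncations) $$[\![(a_1,\epsilon_1);(a_2,\epsilon_2),\ldots]\!]_o=a_1+\cfrac{\epsilon_1}{a_2+\cfrac{\epsilon_2}{a_3+\cdots}},\qquad \langle\!\langle (a_1,\epsilon_1),(a_2,\epsilon_2),\ldots\rangle\!\rangle_o=\cfrac{\epsilon_1}{a_1+\cfrac{\epsilon_2}{a_2+\cdots}},$$ and let an overline denote infinite periodic repetition. Then a geodesic $\bar\gamma$ on $\mathcal M_o$ is closed if and only if it has a lift $\gamma$ such that 1. $\gamma\in\mathcal A_o$, or $\gamma$ is the geodesic with $(\gamma_\infty,\gamma_{-\infty})=(G^2,\,2-G)$; and 2. $\gamma$ has purely periodic endpoints $$\gamma_\infty=\epsilon\,[\![\,\overline{(a_1,\epsilon_1);(a_2,\epsilon_2),\ldots,(a_r,\epsilon_r)}\,]\!]_o,\qquad \gamma_{-\infty}=-\epsilon\,\langle\!\langle\,\overline{(a_r,\epsilon_r),\ldots,(a_2,\epsilon_2),(a_1,\epsilon_1)}\,\rangle\!\rangle_o$$ for some $\epsilon\in\{\pm1\}$,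 some $r\geqslant1$ and some digits $(a_1,\epsilon_1),\ldots,(a_r,\epsilon_r)$ as above with $(-\epsilon_1)\cdots(-\epsilon_r)=1$. -/

import Mathlib

open Filter Topology Set
open scoped UpperHalfPlane MatrixGroups

namespace OddCF

/-! ### Odd and grotesque continued fractions -/

/-- A digit `(a, ε)`, with `a` a natural number and `ε = ± 1`. -/
abbrev Digit : Type := ℕ × ℤˣ

/-- The condition on digits of odd and of grotesque continued fractions:
`a` is an odd positive integer, `ε = ± 1`, and `a + ε ≥ 2`. -/
def Digit.Admissible (d : Digit) : Prop :=
  Odd d.1 ∧ 2 ≤ (d.1 : ℤ) + (d.2 : ℤ)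

/-- The real number `± 1` given by a sign. -/
def sgn (u : ℤˣ) : ℝ := ((u : ℤ) : ℝ)

/-- The finite truncation `a₀ + ε₀ / (a₁ + ε₁ / (a₂ + ⋯ + ε_{n-1} / a_n))`. -/
noncomputable def ocfConvergent : (ℕ → Digit) → ℕ → ℝ
  | d, 0 => ((d 0).1 : ℝ)
  | d, n + 1 => ((d 0).1 : ℝ) + sgn (d 0).2 / ocfConvergent (fun k => d (k + 1)) n

/-- The finite truncation `ε₀ / (b₀ + ε₁ / (b₁ + ⋯ + ε_n / b_n))`. -/
noncomputable def gcfConvergent : (ℕ → Digit) → ℕ → ℝ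
  | d, 0 => sgn (d 0).2 / ((d 0).1 : ℝ)
  | d, n + 1 => sgn (d 0).2 / (((d 0).1 : ℝ) + gcfConvergent (fun k => d (k + 1)) n)

/-- `x = ⟦(a₀, ε₀); (a₁, ε₁), (a₂, ε₂), …⟧_o = a₀ + ε₀ / (a₁ + ε₁ / (a₂ + ⋯))`. -/
def HasOCF (d : ℕ → Digit) (x : ℝ) : Prop :=
  (∀ n, (d n).Admissible) ∧ Tendsto (ocfConvergent d) atTop (𝓝 x)

/-- `y = ⟪(b₀, ε₀), (b₁, ε₁), (b₂, ε₂), …⟫_o = ε₀ / (b₀ + ε₁ / (b₁ + ε₂ / (b₂ + ⋯)))`. -/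
def HasGCF (d : ℕ → Digit) (y : ℝ) : Prop :=
  (∀ n, (d n).Admissible) ∧ Tendsto (gcfConvergent d) atTop (𝓝 y)

/-- The purely periodic digit sequence that repeats a nonempty word. -/
def periodicDigits {r : ℕ} (hr : 0 < r) (w : Fin r → Digit) : ℕ → Digit :=
  fun n => w ⟨n % r, Nat.mod_lt n hr⟩

/-! ### The group and the modular surface -/

/-- The matrix of `S(z) = -1 / (z + 1)`. -/
def matS : SL(2, ℤ) := ⟨!![0, -1; 1, 1], by simp⟩

/-- The matrix of `T(z) = z + 2`. -/
def matT : SL(2, ℤ) := ⟨!![1, 2; 0, 1], by simp⟩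

/-- The group generated by `S` and `T`. It is taken in `SL(2, ℤ)`, whose centre `{1, -1}` acts
trivially on `ℍ`, so that it has the same orbits as its image in `PSL(2, ℤ)`. -/
def Gam : Subgroup SL(2, ℤ) := Subgroup.closure {matS, matT}

/-- The modular surface `M_o`, the quotient of `ℍ` by the group generated by `S` and `T`. -/
abbrev Mo : Type := MulAction.orbitRel.Quotient Gam ℍ

/-- The projection `π_o : ℍ → M_o`. -/
noncomputable def proj (z : ℍ) : Mo := Quotient.mk (MulAction.orbitRel Gam ℍ) z

/-! ### Geodesics -/

/-- An oriented (complete, unit speed) geodesic of `ℍ`: an isometric embedding of the line for the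
hyperbolic distance. -/
def IsGeodesic (γ : ℝ → ℍ) : Prop := Isometry γ

/-- `γ` is a lift to `ℍ` of the curve `c` on `M_o`, as an oriented geodesic. -/
def IsLift (γ : ℝ → ℍ) (c : ℝ → Mo) : Prop := IsGeodesic γ ∧ ∀ t, proj (γ t) = c t

/-- The geodesics on `M_o` are the projections of the geodesics of `ℍ`. -/
def IsGeodesicMo (c : ℝ → Mo) : Prop := ∃ γ, IsLift γ c

/-- A geodesic on `M_o` is closed if it comes back periodically. -/
def IsClosedGeodesic (c : ℝ → Mo) : Prop :=
  IsGeodesicMo c ∧ ∃ T : ℝ, 0 < T ∧ Function.Periodic c T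

/-- The forward endpoint of `γ` is the real number `x`. -/
def ForwardEndpoint (γ : ℝ → ℍ) (x : ℝ) : Prop :=
  Tendsto (fun t => (γ t : ℂ)) atTop (𝓝 (x : ℂ))

/-- The backward endpoint of `γ` is the real number `y`. -/
def BackwardEndpoint (γ : ℝ → ℍ) (y : ℝ) : Prop :=
  Tendsto (fun t => (γ t : ℂ)) atBot (𝓝 (y : ℂ))

/-- The interval `I_G = (G - 2, G)`, where `G = (√5 + 1) / 2`. -/
noncomputable def IG : Set ℝ := Ioo (Real.goldenRatio - 2) Real.goldenRatio

/-- `S_o = ((1, ∞) × (-I_G)) ∪ ((-∞, -1) × I_G)`. -/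
def So : Set (ℝ × ℝ) :=
  {p | (1 < p.1 ∧ -p.2 ∈ IG) ∨ (p.1 < -1 ∧ p.2 ∈ IG)}

/-- `A_o`, the set of oriented geodesics of `ℍ` whose pair (forward endpoint, backward endpoint)
lies in `S_o`. -/
def Ao : Set (ℝ → ℍ) :=
  {γ | IsGeodesic γ ∧ ∃ x y, ForwardEndpoint γ x ∧ BackwardEndpoint γ y ∧ (x, y) ∈ So}

/-- `γ` has the purely periodic endpoints
`γ_∞ = ε ⟦ overline (a₁, ε₁); …, (a_r, ε_r) ⟧_o` and
`γ_{-∞} = - ε ⟪ overline (a_r, ε_r), …, (a₁, ε₁) ⟫_o`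
for some `ε = ± 1` and some word with `r ≥ 1` and `(-ε₁) ⋯ (-ε_r) = 1`. -/
def HasPeriodicEndpoints (γ : ℝ → ℍ) : Prop :=
  ∃ (r : ℕ) (hr : 0 < r) (w : Fin r → Digit) (ε : ℤˣ) (α β : ℝ),
    HasOCF (periodicDigits hr w) α ∧
    HasGCF (periodicDigits hr (fun i => w i.rev)) β ∧
    ForwardEndpoint γ (sgn ε * α) ∧
    BackwardEndpoint γ (-(sgn ε) * β) ∧
    ∏ i, (-(w i).2) = 1

end OddCF

namespace OddCF

/-! ### Geodesics of the upper half-plane -/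

/-! A geodesic on the quotient is closed exactly when a lift is the axis of a hyperbolic element of
Γ, and one continued fraction step is the action of an element of Γ on both endpoints at once. For a
digit (a, e) with a odd, and m = εa, the map z ↦ 1/(m - z) lies in Γ. It sends the pair (εα, -εβ) to
(ε'α', -ε'β'), where α = a + e/α', β' = e/(a + β) and ε' = -eε. So the forward digits are shifted,
the same digits pile up in reverse order in the backward endpoint, and the sign is multiplied by -e
(`exists_mob_of_steps`).

Periodic implies closed: after one period with sign product 1, the product of these matrices fixes
both endpoints. Its automorphy factor at the forward endpoint is a product of numbers of absolute
value 1/α' < 1, so it is hyperbolic and translates the lift along itself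
(`IsLift.isClosedGeodesic`).

Closed implies periodic: since Γ is countable and time is not, a single P in Γ translates a lift
(`IsClosedGeodesic.exists_fixed`). Its fixed points are irrational. After an even translation the
forward endpoint exceeds 1 and can be expanded. Unless all digits are eventually (3, -1), the
backward coordinates β enter I_G and stay there (`exists_neg_half_lt`, `eventually_mem_IG_or`). From
then on the conjugates of P have fixed eigenvalues and fixed points that are uniformly separated,
one of them bounded, so their entries are bounded (`bounded_of_mob`). Two conjugates coincide, hence
so do two pairs of endpoints, and the expansion is purely periodic from there. If the digits end in
(3, -1), then α = G² and, by conjugation, β = G - 2, an endpoint of the open interval I_G; this is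
the exceptional geodesic. -/

/-- The standard geodesic `t ↦ i e ^ t`. -/
noncomputable def stdGeodesic (t : ℝ) : ℍ :=
  ⟨(Real.exp t : ℂ) * Complex.I, by
    simpa [-Complex.ofReal_exp] using Real.exp_pos t⟩

lemma stdGeodesic_coe (t : ℝ) : (stdGeodesic t : ℂ) = ((Real.exp t : ℝ) : ℂ) * Complex.I := by
  simp [stdGeodesic]

lemma stdGeodesic_re (t : ℝ) : (stdGeodesic t).re = 0 := by
  rw [← UpperHalfPlane.coe_re, stdGeodesic_coe]; simp [-Complex.ofReal_exp]

lemma stdGeodesic_im (t : ℝ) : (stdGeodesic t).im = Real.exp t := by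
  rw [← UpperHalfPlane.coe_im, stdGeodesic_coe]; simp [-Complex.ofReal_exp]

lemma stdGeodesic_zero : stdGeodesic 0 = UpperHalfPlane.I := by
  ext; simp [stdGeodesic_coe]

lemma cosh_dist_stdGeodesic (z : ℍ) (s : ℝ) :
    z.re ^ 2 + z.im ^ 2 + Real.exp s ^ 2 =
      2 * z.im * Real.exp s * Real.cosh (dist z (stdGeodesic s)) := by
  have h := UpperHalfPlane.cosh_dist' z (stdGeodesic s)
  rw [stdGeodesic_re, stdGeodesic_im] at h
  have h1 := z.im_pos
  have h2 := Real.exp_pos s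
  rw [h]; field_simp; ring

/-- An isometric embedding of the line that agrees with the standard geodesic at two times
is the standard geodesic. -/
lemma eq_stdGeodesic {σ : ℝ → ℍ} (hσ : Isometry σ) {s u : ℝ} (hsu : s ≠ u)
    (hs : σ s = stdGeodesic s) (hu : σ u = stdGeodesic u) : σ = stdGeodesic := by
  funext t
  -- The distances to two points of the axis give two equations that share |σ t|². Subtracting them
  -- isolates the imaginary part.
  have key : ∀ v, σ v = stdGeodesic v →
      (σ t).re ^ 2 + (σ t).im ^ 2 + Real.exp v ^ 2 =
        (σ t).im * (Real.exp t + Real.exp v ^ 2 * Real.exp (-t)) := by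
    intro v hv
    have h := cosh_dist_stdGeodesic (σ t) v
    rw [← hv, hσ.dist_eq, Real.dist_eq, Real.cosh_abs, Real.cosh_eq] at h
    have e1 : Real.exp v * Real.exp (t - v) = Real.exp t := by rw [← Real.exp_add]; ring_nf
    have e2 : Real.exp v * Real.exp (-(t - v)) = Real.exp v ^ 2 * Real.exp (-t) := by
      rw [pow_two, ← Real.exp_add, ← Real.exp_add, ← Real.exp_add]; ring_nf
    rw [h]
    linear_combination (σ t).im * e1 + (σ t).im * e2
  have h1 := key s hs
  have h2 := key u hu
  have hne : Real.exp s ^ 2 - Real.exp u ^ 2 ≠ 0 := by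
    rw [sub_ne_zero]
    intro h
    have := (pow_left_inj₀ (Real.exp_pos s).le (Real.exp_pos u).le two_ne_zero).1 h
    exact hsu (Real.exp_injective this)
  have h3 : (σ t).im * Real.exp (-t) = 1 := by
    apply mul_left_cancel₀ hne
    linear_combination h2 - h1
  have hee : Real.exp t * Real.exp (-t) = 1 := by rw [← Real.exp_add]; simp
  have him : (σ t).im = Real.exp t := by
    calc (σ t).im = (σ t).im * (Real.exp t * Real.exp (-t)) := by rw [hee, mul_one]
      _ = ((σ t).im * Real.exp (-t)) * Real.exp t := by ring
      _ = _ := by rw [h3, one_mul]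
  have hre : (σ t).re = 0 := by
    have : (σ t).re ^ 2 = 0 := by
      rw [him] at h1
      linear_combination h1 + Real.exp s ^ 2 * hee
    exact pow_eq_zero_iff two_ne_zero |>.1 this
  apply UpperHalfPlane.ext
  apply Complex.ext
  · simpa [stdGeodesic_re] using hre
  · simpa [stdGeodesic_im] using him

lemma coe_smul_real (h : SL(2, ℝ)) (z : ℍ) :
    ((h • z : ℍ) : ℂ) = ((h 0 0 : ℝ) * (z : ℂ) + (h 0 1 : ℝ)) / ((h 1 0 : ℝ) * z + (h 1 1 : ℝ)) := by
  rw [UpperHalfPlane.coe_specialLinearGroup_apply]; simp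

/-- The stabilizer of i consists of rotations, and one of them turns any point onto the imaginary
axis. -/
lemma exists_rotation (p : ℍ) :
    ∃ k : SL(2, ℝ), k • UpperHalfPlane.I = UpperHalfPlane.I ∧ (k • p).re = 0 := by
  -- The left side is the real part of (p + t) times the conjugate of (1 - tp), so it vanishes when
  -- (p + t)/(1 - tp) is purely imaginary.
  obtain ⟨t, ht⟩ : ∃ t : ℝ, t * (1 - p.re ^ 2 - p.im ^ 2) + p.re * (1 - t ^ 2) = 0 := by
    by_cases hx : p.re = 0
    · exact ⟨0, by simp [hx]⟩
    · set b := 1 - p.re ^ 2 - p.im ^ 2 with hb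
      have hsq : Real.sqrt (b ^ 2 + 4 * p.re ^ 2) ^ 2 = b ^ 2 + 4 * p.re ^ 2 :=
        Real.sq_sqrt (by positivity)
      refine ⟨(b + Real.sqrt (b ^ 2 + 4 * p.re ^ 2)) / (2 * p.re), ?_⟩
      field_simp
      linear_combination -hsq
  have hpos : 0 < 1 + t ^ 2 := by positivity
  set c := (Real.sqrt (1 + t ^ 2))⁻¹ with hc
  have hc2 : c ^ 2 * (1 + t ^ 2) = 1 := by
    rw [hc, inv_pow, Real.sq_sqrt hpos.le, inv_mul_cancel₀ hpos.ne']
  have hcpos : 0 < c := by rw [hc]; positivity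
  have hdet : (!![c, t * c; -(t * c), c] : Matrix (Fin 2) (Fin 2) ℝ).det = 1 := by
    rw [Matrix.det_fin_two_of]; linear_combination hc2
  set k : SL(2, ℝ) := ⟨!![c, t * c; -(t * c), c], hdet⟩ with hk
  refine ⟨k, ?_, ?_⟩
  · apply UpperHalfPlane.ext
    rw [coe_smul_real]
    simp only [hk, Matrix.SpecialLinearGroup.coe_mk, Matrix.of_apply, Matrix.cons_val', Matrix.cons_val_zero,
      Matrix.cons_val_one, Matrix.cons_val_fin_one, UpperHalfPlane.coe_I]
    rw [div_eq_iff]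
    · push_cast
      linear_combination ((t * c : ℂ)) * Complex.I_mul_I
    · intro h
      have := congrArg Complex.re h
      simp at this
      exact hcpos.ne' this
  · rw [← UpperHalfPlane.coe_re, coe_smul_real]
    simp only [hk, Matrix.SpecialLinearGroup.coe_mk, Matrix.of_apply, Matrix.cons_val', Matrix.cons_val_zero,
      Matrix.cons_val_one, Matrix.cons_val_fin_one]
    rw [Complex.div_re]
    simp only [Complex.add_re, Complex.mul_re, Complex.ofReal_re, Complex.ofReal_im,
      UpperHalfPlane.coe_re, UpperHalfPlane.coe_im, Complex.add_im, Complex.mul_im]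
    rw [← add_div]
    apply div_eq_zero_iff.2
    left
    linear_combination c ^ 2 * ht

lemma exists_smul_eq_stdGeodesic {p q : ℍ} (hpq : dist p q = 1) :
    ∃ h : SL(2, ℝ), h • p = stdGeodesic 0 ∧ h • q = stdGeodesic 1 := by
  obtain ⟨h₁, hh₁⟩ := MulAction.exists_smul_eq SL(2, ℝ) p UpperHalfPlane.I
  obtain ⟨k, hkI, hk⟩ := exists_rotation (h₁ • q)
  have hd : dist (k • h₁ • q) (stdGeodesic 0) = 1 := by
    rw [stdGeodesic_zero]
    conv_lhs => rw [← hkI, ← hh₁]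
    rw [dist_smul, dist_smul, dist_comm, hpq]
  set w := k • h₁ • q with hw
  have hc := cosh_dist_stdGeodesic w 0
  rw [hd, hk, Real.exp_zero, Real.cosh_eq] at hc
  have hee : Real.exp 1 * Real.exp (-1) = 1 := by rw [← Real.exp_add]; simp
  have hprod : (w.im - Real.exp 1) * (w.im - Real.exp (-1)) = 0 := by
    linear_combination hc + hee
  rcases mul_eq_zero.1 hprod with h | h
  · refine ⟨k * h₁, by rw [mul_smul, hh₁, hkI, stdGeodesic_zero], ?_⟩
    rw [mul_smul, ← hw]
    apply UpperHalfPlane.ext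
    apply Complex.ext
    · simpa [stdGeodesic_re] using hk
    · rw [UpperHalfPlane.coe_im, UpperHalfPlane.coe_im, stdGeodesic_im]; linarith
  -- Here q landed at i/e, below i; z ↦ -1/z fixes i and reverses the axis.
  · set S : SL(2, ℝ) := ⟨!![0, -1; 1, 0], by simp⟩ with hS
    refine ⟨S * (k * h₁), ?_, ?_⟩
    · rw [mul_smul, mul_smul, hh₁, hkI, stdGeodesic_zero]
      apply UpperHalfPlane.ext
      rw [coe_smul_real]
      simp [hS]
    · rw [mul_smul, mul_smul, ← hw]
      apply UpperHalfPlane.ext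
      rw [coe_smul_real, stdGeodesic_coe]
      have hwc : (w : ℂ) = ((Real.exp (-1) : ℝ) : ℂ) * Complex.I := by
        apply Complex.ext
        · simpa [← Complex.ofReal_exp] using hk
        · rw [UpperHalfPlane.coe_im]; simp [-Complex.ofReal_exp]; linarith
      have hee' : ((Real.exp 1 : ℝ) : ℂ) * ((Real.exp (-1) : ℝ) : ℂ) = 1 := by
        exact_mod_cast congrArg (fun r : ℝ => (r : ℂ)) hee
      rw [div_eq_iff]
      · rw [hwc]
        simp only [hS, Matrix.SpecialLinearGroup.coe_mk, Matrix.of_apply, Matrix.cons_val',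
          Matrix.cons_val_zero, Matrix.cons_val_one, Matrix.cons_val_fin_one]
        push_cast at hee' ⊢
        linear_combination -Complex.I_mul_I - Complex.I ^ 2 * hee'
      · simpa [hS] using w.ne_zero

lemma isometry_smul_real (h : SL(2, ℝ)) {γ : ℝ → ℍ} (hγ : Isometry γ) :
    Isometry (fun t => h • γ t) := (isometry_smul ℍ h).comp hγ

/-- Every geodesic is the image of the standard one. -/
lemma IsGeodesic.exists_eq_smul {γ : ℝ → ℍ} (hγ : IsGeodesic γ) :
    ∃ h : SL(2, ℝ), ∀ t, γ t = h • stdGeodesic t := by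
  obtain ⟨h, h0, h1⟩ := exists_smul_eq_stdGeodesic (p := γ 0) (q := γ 1)
    (by rw [Isometry.dist_eq hγ]; simp)
  have := eq_stdGeodesic (isometry_smul_real h hγ) zero_ne_one h0 h1
  refine ⟨h⁻¹, fun t => ?_⟩
  rw [← this, inv_smul_smul]

lemma IsGeodesic.eq_of_eq {γ δ : ℝ → ℍ} (hγ : IsGeodesic γ) (hδ : IsGeodesic δ) {s u : ℝ}
    (hsu : s ≠ u) (hs : γ s = δ s) (hu : γ u = δ u) : γ = δ := by
  obtain ⟨h, hh⟩ := hδ.exists_eq_smul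
  have := eq_stdGeodesic (isometry_smul_real h⁻¹ hγ) hsu
    (by rw [hs, hh, inv_smul_smul]) (by rw [hu, hh, inv_smul_smul])
  funext t
  rw [hh, ← this, smul_inv_smul]

/-! ### Endpoints -/

lemma im_tendsto_of_endpoint {γ : ℝ → ℍ} {l : Filter ℝ} {x : ℝ}
    (h : Tendsto (fun t => (γ t : ℂ)) l (𝓝 (x : ℂ))) : Tendsto (fun t => (γ t).im) l (𝓝 0) := by
  simpa [Function.comp_def] using (Complex.continuous_im.tendsto _).comp h

lemma tendsto_smul_stdGeodesic_atBot (h : SL(2, ℝ)) (hd : h 1 1 ≠ 0) :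
    Tendsto (fun t => ((h • stdGeodesic t : ℍ) : ℂ)) atBot (𝓝 ((h 0 1 / h 1 1 : ℝ) : ℂ)) := by
  simp only [coe_smul_real, stdGeodesic_coe]
  have h0 : Tendsto (fun t : ℝ => ((Real.exp t : ℝ) : ℂ)) atBot (𝓝 0) := by
    simpa [Function.comp_def] using (Complex.continuous_ofReal.tendsto 0).comp Real.tendsto_exp_atBot
  have hd' : (h 1 1 : ℂ) ≠ 0 := by exact_mod_cast hd
  have hl : ∀ a b : ℂ, Tendsto (fun t : ℝ => a * (((Real.exp t : ℝ) : ℂ) * Complex.I) + b) atBot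
      (𝓝 b) := by
    intro a b
    simpa using ((h0.mul_const Complex.I).const_mul a).add_const b
  simpa [Pi.div_def] using (hl (h 0 0) (h 0 1)).div (hl (h 1 0) (h 1 1)) hd'

lemma tendsto_smul_stdGeodesic_atTop (h : SL(2, ℝ)) (hc : h 1 0 ≠ 0) :
    Tendsto (fun t => ((h • stdGeodesic t : ℍ) : ℂ)) atTop (𝓝 ((h 0 0 / h 1 0 : ℝ) : ℂ)) := by
  simp only [coe_smul_real, stdGeodesic_coe]
  have h0 : Tendsto (fun t : ℝ => ((Real.exp (-t) : ℝ) : ℂ)) atTop (𝓝 0) := by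
    simpa [Function.comp_def] using (Complex.continuous_ofReal.tendsto 0).comp
      (Real.tendsto_exp_atBot.comp tendsto_neg_atTop_atBot)
  have hc' : (h 1 0 : ℂ) * Complex.I ≠ 0 := mul_ne_zero (by exact_mod_cast hc) Complex.I_ne_zero
  have hl : ∀ a b : ℂ, Tendsto (fun t : ℝ => a * Complex.I + b * ((Real.exp (-t) : ℝ) : ℂ)) atTop
      (𝓝 (a * Complex.I)) := by
    intro a b
    simpa using (h0.const_mul b).const_add (a * Complex.I)
  have := (hl (h 0 0) (h 0 1)).div (hl (h 1 0) (h 1 1)) hc'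
  rw [mul_div_mul_right _ _ Complex.I_ne_zero] at this
  rw [Complex.ofReal_div]
  refine this.congr fun t => ?_
  have hee : ((Real.exp t : ℝ) : ℂ) * ((Real.exp (-t) : ℝ) : ℂ) = 1 := by
    rw [← Complex.ofReal_mul, ← Real.exp_add]; simp
  have hne : ((Real.exp t : ℝ) : ℂ) ≠ 0 := left_ne_zero_of_mul_eq_one hee
  rw [Pi.div_apply, ← mul_div_mul_left _ _ hne]
  congr 1
  · linear_combination (h 0 1 : ℂ) * hee
  · linear_combination (h 1 1 : ℂ) * hee

lemma im_smul_real (h : SL(2, ℝ)) (z : ℍ) :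
    (h • z).im * ((h 1 0 * z.re + h 1 1) ^ 2 + (h 1 0 * z.im) ^ 2) = z.im := by
  have h1 := UpperHalfPlane.coe_im (h • z)
  rw [coe_smul_real, Complex.div_im] at h1
  have hn : Complex.normSq ((h 1 0 : ℝ) * (z : ℂ) + (h 1 1 : ℝ)) =
      (h 1 0 * z.re + h 1 1) ^ 2 + (h 1 0 * z.im) ^ 2 := by
    rw [Complex.normSq_apply]; simp; ring
  have hdet := h.det_coe
  rw [Matrix.det_fin_two] at hdet
  have hne : (h 1 0 * z.re + h 1 1) ^ 2 + (h 1 0 * z.im) ^ 2 ≠ 0 := by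
    intro h0
    have h2 : h 1 0 * z.re + h 1 1 = 0 := by nlinarith [sq_nonneg (h 1 0 * z.re + h 1 1), sq_nonneg (h 1 0 * z.im)]
    have h3 : h 1 0 * z.im = 0 := by nlinarith [sq_nonneg (h 1 0 * z.re + h 1 1), sq_nonneg (h 1 0 * z.im)]
    have h4 : h 1 0 = 0 := (mul_eq_zero.1 h3).resolve_right z.im_pos.ne'
    have h5 : h 1 1 = 0 := by rw [h4] at h2; linarith
    rw [h4, h5] at hdet
    simp at hdet
  rw [hn, ← sub_div] at h1
  rw [← h1, div_mul_cancel₀ _ hne]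
  simp
  linear_combination z.im * hdet

/-- If the lower left entry were 0, the imaginary part would be a multiple of e^t, which no real
endpoint allows. Otherwise the limit is h(∞). -/
lemma ForwardEndpoint.eq {h : SL(2, ℝ)} {x : ℝ}
    (hx : ForwardEndpoint (fun t => h • stdGeodesic t) x) : h 1 0 ≠ 0 ∧ h 0 0 = x * h 1 0 := by
  have hc : h 1 0 ≠ 0 := by
    intro h0
    have h1 := im_tendsto_of_endpoint hx
    have h2 := h1.mul_const ((h 1 1) ^ 2)
    have h3 : (fun t => (h • stdGeodesic t).im * (h 1 1) ^ 2) = Real.exp := by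
      funext t
      have := im_smul_real h (stdGeodesic t)
      rw [h0, stdGeodesic_im] at this
      linarith
    rw [h3, zero_mul] at h2
    exact not_tendsto_nhds_of_tendsto_atTop Real.tendsto_exp_atTop _ h2
  have := tendsto_nhds_unique hx (tendsto_smul_stdGeodesic_atTop h hc)
  exact ⟨hc, by rw [Complex.ofReal_injective this, div_mul_cancel₀ _ hc]⟩

lemma BackwardEndpoint.eq {h : SL(2, ℝ)} {y : ℝ}
    (hy : BackwardEndpoint (fun t => h • stdGeodesic t) y) : h 1 1 ≠ 0 ∧ h 0 1 = y * h 1 1 := by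
  have hc : h 1 1 ≠ 0 := by
    intro h0
    have h1 := im_tendsto_of_endpoint hy
    have h2 := h1.mul_const ((h 1 0) ^ 2)
    have h3 : ∀ t, (h • stdGeodesic t).im * (h 1 0) ^ 2 = Real.exp (-t) := by
      intro t
      have := im_smul_real h (stdGeodesic t)
      rw [h0, stdGeodesic_im, stdGeodesic_re] at this
      have hee : Real.exp t * Real.exp (-t) = 1 := by rw [← Real.exp_add]; simp
      apply mul_right_cancel₀ (Real.exp_pos t).ne'
      apply mul_right_cancel₀ (Real.exp_pos t).ne'
      linear_combination this - Real.exp t * hee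
    simp only [h3, zero_mul] at h2
    exact not_tendsto_nhds_of_tendsto_atTop (Real.tendsto_exp_atTop.comp tendsto_neg_atBot_atTop) _ h2
  have := tendsto_nhds_unique hy (tendsto_smul_stdGeodesic_atBot h hc)
  exact ⟨hc, by rw [Complex.ofReal_injective this, div_mul_cancel₀ _ hc]⟩

/-! ### The action on real endpoints -/

/-- `M (x, 1) = j (x', 1)`: the Möbius transformation `M` maps `x` to `x'`, with automorphy
factor `j`. -/
def Mob (M : SL(2, ℤ)) (j x x' : ℝ) : Prop :=
  (M 0 0 : ℝ) * x + M 0 1 = j * x' ∧ (M 1 0 : ℝ) * x + M 1 1 = j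

lemma det_cast (M : SL(2, ℤ)) : (M 0 0 : ℝ) * M 1 1 - M 0 1 * M 1 0 = 1 := by
  have := M.det_coe
  rw [Matrix.det_fin_two] at this
  exact_mod_cast this

lemma Mob.mul {M N : SL(2, ℤ)} {j k x x' x'' : ℝ} (hN : Mob N k x' x'') (hM : Mob M j x x') :
    Mob (N * M) (k * j) x x'' := by
  obtain ⟨h1, h2⟩ := hM
  obtain ⟨h3, h4⟩ := hN
  simp only [Mob, Matrix.SpecialLinearGroup.coe_mul, Matrix.mul_apply, Fin.sum_univ_two]
  push_cast
  constructor
  · linear_combination (N 0 0 : ℝ) * h1 + (N 0 1 : ℝ) * h2 + j * h3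
  · linear_combination (N 1 0 : ℝ) * h1 + (N 1 1 : ℝ) * h2 + j * h4

lemma Mob.one (x : ℝ) : Mob 1 1 x x := by simp [Mob]

lemma Mob.ne_zero {M : SL(2, ℤ)} {j x x' : ℝ} (hM : Mob M j x x') : j ≠ 0 := by
  rintro rfl
  obtain ⟨h1, h2⟩ := hM
  have := det_cast M
  have h3 : (1 : ℝ) = 0 := by
    linear_combination -this + (M 0 0 : ℝ) * h2 - (M 1 0 : ℝ) * h1
  exact one_ne_zero h3

lemma Mob.inv {M : SL(2, ℤ)} {j x x' : ℝ} (hM : Mob M j x x') : Mob M⁻¹ j⁻¹ x' x := by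
  have hj := hM.ne_zero
  obtain ⟨h1, h2⟩ := hM
  have := det_cast M
  simp only [Mob, Matrix.SpecialLinearGroup.SL2_inv_expl, Matrix.cons_val', Matrix.cons_val_zero, Matrix.cons_val_one,
    Matrix.cons_val_fin_one]
  push_cast
  constructor
  · field_simp
    linear_combination -(M 1 1 : ℝ) * h1 + (M 0 1 : ℝ) * h2 + x * this
  · field_simp
    linear_combination (M 1 0 : ℝ) * h1 - (M 0 0 : ℝ) * h2 + this

/-- The factors of M and M⁻¹ cancel, so the eigenvalue survives conjugation. The later finiteness
argument rests on this. -/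
lemma Mob.conj {P M : SL(2, ℤ)} {l j x x' : ℝ} (hP : Mob P l x x) (hM : Mob M j x x') :
    Mob (M * P * M⁻¹) l x' x' := by
  have := (hM.mul hP).mul hM.inv
  rwa [mul_right_comm, mul_inv_cancel₀ hM.ne_zero, one_mul] at this

lemma coe_smul_int (M : SL(2, ℤ)) (z : ℍ) :
    ((M • z : ℍ) : ℂ) = ((M 0 0 : ℤ) * (z : ℂ) + (M 0 1 : ℤ)) / ((M 1 0 : ℤ) * z + (M 1 1 : ℤ)) := by
  rw [UpperHalfPlane.coe_specialLinearGroup_apply]; simp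

/-- The real matrix of an integral one. -/
def toRealSL (M : SL(2, ℤ)) : SL(2, ℝ) := Matrix.SpecialLinearGroup.map (Int.castRingHom ℝ) M

lemma toRealSL_apply (M : SL(2, ℤ)) (i j : Fin 2) : toRealSL M i j = (M i j : ℝ) := by
  simp [toRealSL]

lemma toRealSL_smul (M : SL(2, ℤ)) (z : ℍ) : toRealSL M • z = M • z := by
  apply UpperHalfPlane.ext
  rw [coe_smul_real, coe_smul_int]
  simp [toRealSL_apply]

lemma IsGeodesic.smul {γ : ℝ → ℍ} (hγ : IsGeodesic γ) (M : SL(2, ℤ)) :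
    IsGeodesic (fun t => M • γ t) := by
  have := isometry_smul_real (toRealSL M) hγ
  simp only [toRealSL_smul] at this
  exact this

lemma tendsto_smul_of_mob {γ : ℝ → ℍ} {l : Filter ℝ} {x x' j : ℝ} {M : SL(2, ℤ)}
    (h : Tendsto (fun t => (γ t : ℂ)) l (𝓝 (x : ℂ))) (hM : Mob M j x x') :
    Tendsto (fun t => ((M • γ t : ℍ) : ℂ)) l (𝓝 (x' : ℂ)) := by
  simp only [coe_smul_int]
  have hj : (j : ℂ) ≠ 0 := by exact_mod_cast hM.ne_zero
  have h1 : ((M 0 0 : ℤ) : ℂ) * x + (M 0 1 : ℤ) = j * x' := by exact_mod_cast congrArg (fun r : ℝ => (r : ℂ)) hM.1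
  have h2 : ((M 1 0 : ℤ) : ℂ) * x + (M 1 1 : ℤ) = j := by exact_mod_cast congrArg (fun r : ℝ => (r : ℂ)) hM.2
  have := ((h.const_mul ((M 0 0 : ℤ) : ℂ)).add_const ((M 0 1 : ℤ) : ℂ)).div
    ((h.const_mul ((M 1 0 : ℤ) : ℂ)).add_const ((M 1 1 : ℤ) : ℂ)) (by rw [h2]; exact hj)
  rw [h1, h2, mul_div_cancel_left₀ _ hj] at this
  simpa [Pi.div_def] using this

lemma proj_smul {M : SL(2, ℤ)} (hM : M ∈ Gam) (z : ℍ) : proj (M • z) = proj z :=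
  Quotient.sound (s := MulAction.orbitRel Gam ℍ) ⟨⟨M, hM⟩, rfl⟩

lemma exists_smul_of_proj_eq {z w : ℍ} (h : proj z = proj w) : ∃ M : Gam, M • w = z :=
  Quotient.exact (s := MulAction.orbitRel Gam ℍ) h

lemma IsLift.smul {γ : ℝ → ℍ} {c : ℝ → Mo} (h : IsLift γ c) {M : SL(2, ℤ)} (hM : M ∈ Gam) :
    IsLift (fun t => M • γ t) c :=
  ⟨h.1.smul M, fun t => by rw [proj_smul hM, h.2]⟩

/-! ### Closed geodesics and hyperbolic elements -/

/-- If the endpoints of a lift are the fixed points of an element of `Γ` that is not `± 1`,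
then the geodesic is closed. -/
lemma IsLift.isClosedGeodesic {γ : ℝ → ℍ} {c : ℝ → Mo} (hγ : IsLift γ c) {x y l m : ℝ}
    (hx : ForwardEndpoint γ x) (hy : BackwardEndpoint γ y) {M : SL(2, ℤ)} (hM : M ∈ Gam)
    (hMx : Mob M l x x) (hMy : Mob M m y y) (hl : |l| < 1) : IsClosedGeodesic c := by
  refine ⟨⟨γ, hγ⟩, ?_⟩
  obtain ⟨h, hh⟩ := hγ.1.exists_eq_smul
  obtain rfl : γ = fun t => h • stdGeodesic t := funext hh
  obtain ⟨hc, hcx⟩ := hx.eq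
  obtain ⟨hd, hdy⟩ := hy.eq
  have hdet := h.det_coe
  rw [Matrix.det_fin_two, hcx, hdy] at hdet
  have hxy : x - y ≠ 0 := by
    intro h0
    have : (0 : ℝ) = 1 := by linear_combination hdet - h 1 0 * h 1 1 * h0
    exact zero_ne_one this
  have hl0 := hMx.ne_zero
  -- x ≠ y, so l and m are the two eigenvalues and their product is the determinant.
  have hlm : l * m = 1 := by
    apply mul_right_cancel₀ hxy
    have hD := det_cast M
    obtain ⟨h1, h2⟩ := hMx
    obtain ⟨h3, h4⟩ := hMy
    linear_combination (x - y) * hD - ((M 1 0 : ℝ) * y + M 1 1) * h1 + ((M 0 0 : ℝ) * y + M 0 1) * h2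
      - l * x * h4 + l * h3
  have hlpos : 0 < |l| := abs_pos.2 hl0
  have hT : 0 < -(2 * Real.log |l|) := by
    have := Real.log_neg hlpos hl; linarith
  have hexp : Real.exp (2 * Real.log |l|) = l ^ 2 := by
    rw [two_mul, Real.exp_add, Real.exp_log hlpos, ← pow_two, sq_abs]
  -- In the coordinate of the axis M is multiplication by l/m = l². As |l| < 1 it moves backwards,
  -- so the period is -2 log |l|.
  have key : ∀ t, M • (h • stdGeodesic t) = h • stdGeodesic (t + 2 * Real.log |l|) := by
    intro t
    apply UpperHalfPlane.ext
    have hden : ∀ s, (h 1 0 : ℂ) * stdGeodesic s + (h 1 1 : ℝ) ≠ 0 := by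
      intro s h0
      have h1 := congrArg Complex.re h0
      simp [stdGeodesic_re] at h1
      exact hd h1
    have hden' : ((M 1 0 : ℤ) : ℂ) * ((h • stdGeodesic t : ℍ) : ℂ) + (M 1 1 : ℤ) ≠ 0 := by
      intro h0
      have h1 := congrArg Complex.im h0
      simp [(h • stdGeodesic t).im_ne_zero] at h1
      rw [h1] at h0
      simp at h0
      have := det_cast M
      simp [h1, h0] at this
    rw [coe_smul_int, coe_smul_real h (stdGeodesic (t + _)), div_eq_div_iff hden' (hden _),
      coe_smul_real]
    have hd1 := hden t
    have hE : ((stdGeodesic (t + 2 * Real.log |l|) : ℍ) : ℂ) = (l : ℂ) ^ 2 * stdGeodesic t := by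
      rw [stdGeodesic_coe, stdGeodesic_coe, Real.exp_add, hexp]; push_cast; ring
    have hMx1 : ((M 0 0 : ℤ) : ℂ) * x + (M 0 1 : ℤ) = l * x := by exact_mod_cast congrArg (fun r : ℝ => (r : ℂ)) hMx.1
    have hMx2 : ((M 1 0 : ℤ) : ℂ) * x + (M 1 1 : ℤ) = l := by exact_mod_cast congrArg (fun r : ℝ => (r : ℂ)) hMx.2
    have hMy1 : ((M 0 0 : ℤ) : ℂ) * y + (M 0 1 : ℤ) = m * y := by exact_mod_cast congrArg (fun r : ℝ => (r : ℂ)) hMy.1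
    have hMy2 : ((M 1 0 : ℤ) : ℂ) * y + (M 1 1 : ℤ) = m := by exact_mod_cast congrArg (fun r : ℝ => (r : ℂ)) hMy.2
    have hlm' : (l : ℂ) * m = 1 := by exact_mod_cast congrArg (fun r : ℝ => (r : ℂ)) hlm
    rw [hE, hcx, hdy]
    push_cast
    set E : ℂ := (stdGeodesic t : ℂ)
    set p : ℂ := (h 1 0 : ℂ)
    set q : ℂ := (h 1 1 : ℂ)
    have hnum : ((M 0 0 : ℤ) : ℂ) * (x * p * E + y * q) + (M 0 1 : ℤ) * (p * E + q)
        = l * x * p * E + m * y * q := by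
      linear_combination p * E * hMx1 + q * hMy1
    have hdenom : ((M 1 0 : ℤ) : ℂ) * (x * p * E + y * q) + (M 1 1 : ℤ) * (p * E + q)
        = l * p * E + m * q := by
      linear_combination p * E * hMx2 + q * hMy2
    have e1 : ((M 0 0 : ℤ) : ℂ) * ((x * p * E + y * q) / (p * E + q)) + (M 0 1 : ℤ)
        = (l * x * p * E + m * y * q) / (p * E + q) := by
      rw [← hnum]; field_simp
    have e2 : ((M 1 0 : ℤ) : ℂ) * ((x * p * E + y * q) / (p * E + q)) + (M 1 1 : ℤ)
        = (l * p * E + m * q) / (p * E + q) := by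
      rw [← hdenom]; field_simp
    rw [e1, e2]
    field_simp
    linear_combination -(p * E * q * l * (x - y)) * hlm'
  refine ⟨_, hT, fun t => ?_⟩
  rw [← hγ.2, ← hγ.2, ← proj_smul hM]
  dsimp only
  rw [key]
  congr 3
  ring

/-- A closed geodesic has a lift whose endpoints are the fixed points of a hyperbolic element
of `Γ`. -/
lemma IsClosedGeodesic.exists_fixed {c : ℝ → Mo} (hc : IsClosedGeodesic c) :
    ∃ (γ : ℝ → ℍ) (M : SL(2, ℤ)) (l x y : ℝ), IsLift γ c ∧ M ∈ Gam ∧ l ^ 2 ≠ 1 ∧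
      ForwardEndpoint γ x ∧ BackwardEndpoint γ y ∧ Mob M l x x ∧ Mob M l⁻¹ y y ∧ x ≠ y := by
  obtain ⟨⟨γ, hγ⟩, T, hT, hper⟩ := hc
  have h1 : ∀ t, ∃ M : Gam, M • γ t = γ (t + T) := fun t =>
    exists_smul_of_proj_eq (by rw [hγ.2, hγ.2, hper])
  choose M hM using h1
  -- Uncountably many times and countably many group elements: one element serves two times, hence
  -- all times, because two points determine a geodesic.
  have hninj : ¬ Function.Injective M := by
    intro hinj
    have : Countable (Matrix (Fin 2) (Fin 2) ℤ) := inferInstanceAs (Countable (Fin 2 → Fin 2 → ℤ))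
    have : Countable SL(2, ℤ) := Subtype.coe_injective.countable
    have : Countable Gam := Subtype.coe_injective.countable
    have : Countable ℝ := hinj.countable
    exact not_countable this
  simp only [Function.Injective, not_forall] at hninj
  obtain ⟨s, u, hsu, hne⟩ := hninj
  have hall : (fun t => (M s : SL(2, ℤ)) • γ t) = fun t => γ (t + T) := by
    refine IsGeodesic.eq_of_eq (hγ.1.smul _) ?_ hne (hM s) ?_
    · exact Isometry.comp hγ.1 (Isometry.of_dist_eq fun a b => by simp)
    · rw [hsu]; exact hM u
  generalize hN : (M s : SL(2, ℤ)) = N at hall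
  have hNG : N ∈ Gam := hN ▸ (M s).2
  obtain ⟨h, hh⟩ := hγ.1.exists_eq_smul
  obtain ⟨k, hk⟩ : ∃ k : SL(2, ℝ), k = h⁻¹ * toRealSL N * h := ⟨_, rfl⟩
  have hkt : ∀ t, k • stdGeodesic t = stdGeodesic (t + T) := by
    intro t
    have := congrFun hall t
    simp only [hh] at this
    rw [hk, mul_smul, mul_smul, toRealSL_smul, this, inv_smul_smul]
  -- Comparing the first identity at two values of t forces k to be diagonal, with entries l and l⁻¹
  -- where l² = e^T.
  have hkeq : ∀ t, k 0 1 = -(Real.exp t * Real.exp t * Real.exp T) * k 1 0 ∧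
      k 0 0 = Real.exp T * k 1 1 := by
    intro t
    have h2 : ((k • stdGeodesic t : ℍ) : ℂ) = (stdGeodesic (t + T) : ℍ) := by rw [hkt t]
    rw [coe_smul_real, div_eq_iff] at h2
    · rw [stdGeodesic_coe, stdGeodesic_coe] at h2
      have hre := congrArg Complex.re h2
      have him := congrArg Complex.im h2
      simp [-Complex.ofReal_exp] at hre him
      rw [Real.exp_add] at hre him
      refine ⟨by linear_combination hre, ?_⟩
      apply mul_right_cancel₀ (Real.exp_pos t).ne'
      linear_combination him
    · intro h0
      have hre := congrArg Complex.re h0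
      have him := congrArg Complex.im h0
      simp [stdGeodesic_re, stdGeodesic_im] at hre him
      have hdet := k.det_coe
      rw [Matrix.det_fin_two, hre, him] at hdet
      simp at hdet
  have hk10 : k 1 0 = 0 := by
    have e0 := (hkeq 0).1
    have e1 := (hkeq 1).1
    rw [Real.exp_zero] at e0
    have h3 : (Real.exp 1 * Real.exp 1 - 1) * Real.exp T * k 1 0 = 0 := by
      linear_combination e1 - e0
    have h4 : 1 < Real.exp 1 := by simp
    have h5 : Real.exp 1 * Real.exp 1 - 1 ≠ 0 := by nlinarith
    simpa [h5] using h3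
  have hk01 : k 0 1 = 0 := by rw [(hkeq 0).1, hk10, mul_zero]
  have hk00 := (hkeq 0).2
  have hkdet := k.det_coe
  rw [Matrix.det_fin_two, hk10, mul_zero, sub_zero] at hkdet
  set l := k 0 0 with hl
  have hl0 : l ≠ 0 := left_ne_zero_of_mul_eq_one hkdet
  have hk11 : k 1 1 = l⁻¹ := eq_inv_of_mul_eq_one_right hkdet
  have hl2 : l ^ 2 = Real.exp T := by
    rw [pow_two]; nth_rw 2 [hk00]; linear_combination Real.exp T * hkdet
  have hl2' : l ^ 2 ≠ 1 := by
    rw [hl2]; exact (Real.one_lt_exp_iff.2 hT).ne'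
  have hNh : toRealSL N * h = h * k := by rw [hk]; group
  have hent : ∀ i j, (toRealSL N * h) i j = (h * k) i j := fun i j => by rw [hNh]
  have e00 := hent 0 0
  have e01 := hent 0 1
  have e10 := hent 1 0
  have e11 := hent 1 1
  simp only [Matrix.SpecialLinearGroup.coe_mul, Matrix.mul_apply, Fin.sum_univ_two,
    toRealSL_apply, hk10, hk01, hk11, ← hl, mul_zero, add_zero, zero_add] at e00 e01 e10 e11
  have hhdet := h.det_coe
  rw [Matrix.det_fin_two] at hhdet
  have hND := det_cast N
  -- Neither endpoint is ∞: an integral matrix of determinant 1 fixing ∞ is triangular with diagonal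
  -- entries ±1, hence not hyperbolic.
  have aux : ∀ a b r : ℝ, (N 1 0 : ℝ) * a = 0 → (N 0 0 : ℝ) * a = a * r → a * b ≠ 0 → r ^ 2 = 1 := by
    intro a b r ha1 ha2 hab
    have ha : a ≠ 0 := left_ne_zero_of_mul hab
    have hn : (N 1 0 : ℝ) = 0 := (mul_eq_zero.1 ha1).resolve_right ha
    rw [hn, mul_zero, sub_zero] at hND
    have hr : (N 0 0 : ℝ) = r := by
      apply mul_right_cancel₀ ha; rw [ha2]; ring
    have hu : N 0 0 * N 1 1 = 1 := by exact_mod_cast hND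
    have := Int.isUnit_iff.1 (IsUnit.of_mul_eq_one _ hu)
    rw [← hr]
    rcases this with h' | h' <;> rw [h'] <;> norm_num
  have hc0 : h 1 0 ≠ 0 := by
    intro h0
    rw [h0] at e10 e00 hhdet
    refine hl2' (aux (h 0 0) (h 1 1) l ?_ ?_ ?_)
    · linarith
    · linarith
    · intro h'; rw [h'] at hhdet; simp at hhdet
  have hd0 : h 1 1 ≠ 0 := by
    intro h0
    rw [h0] at e11 e01 hhdet
    have : l⁻¹ ^ 2 = 1 := by
      refine aux (h 0 1) (h 1 0) l⁻¹ ?_ ?_ ?_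
      · linarith
      · linarith
      · intro h'; rw [h'] at hhdet; simp at hhdet
    rw [inv_pow, inv_eq_one] at this
    exact hl2' this
  have hγ' : γ = fun t => h • stdGeodesic t := funext hh
  refine ⟨γ, N, l, h 0 0 / h 1 0, h 0 1 / h 1 1, hγ, hNG, hl2', ?_, ?_, ⟨?_, ?_⟩, ⟨?_, ?_⟩, ?_⟩
  · rw [hγ']; exact tendsto_smul_stdGeodesic_atTop h hc0
  · rw [hγ']; exact tendsto_smul_stdGeodesic_atBot h hd0
  · field_simp; linarith
  · field_simp; linarith
  · field_simp; field_simp at e01; linarith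
  · field_simp; field_simp at e11; linarith
  · rw [Ne, div_eq_div_iff hc0 hd0]
    intro h0
    rw [h0] at hhdet
    have : (0 : ℝ) = 1 := by linear_combination hhdet
    exact zero_ne_one this

/-! ### Digits -/

lemma sgn_one : sgn 1 = 1 := by simp [sgn]

lemma sgn_neg_one : sgn (-1) = -1 := by simp [sgn]

lemma sgn_mul (u v : ℤˣ) : sgn (u * v) = sgn u * sgn v := by simp [sgn]

lemma sgn_neg (u : ℤˣ) : sgn (-u) = -sgn u := by simp [sgn]

lemma sgn_mul_self (u : ℤˣ) : sgn u * sgn u = 1 := by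
  rcases Int.units_eq_one_or u with rfl | rfl <;> simp [sgn]

lemma abs_sgn (u : ℤˣ) : |sgn u| = 1 := by
  rcases Int.units_eq_one_or u with rfl | rfl <;> simp [sgn]

lemma Digit.Admissible.cases {d : Digit} (h : d.Admissible) :
    (d.2 = 1 ∧ (1 : ℝ) ≤ d.1) ∨ (d.2 = -1 ∧ (3 : ℝ) ≤ d.1) := by
  obtain ⟨ho, h2⟩ := h
  rcases Int.units_eq_one_or d.2 with h | h
  · left
    exact ⟨h, by exact_mod_cast ho.pos⟩
  · right
    refine ⟨h, ?_⟩
    rw [h] at h2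
    obtain ⟨k, hk⟩ := ho
    have : 3 ≤ d.1 := by
      simp at h2
      omega
    exact_mod_cast this

/-- The finite and infinite tails of odd continued fractions all arise from `t'` with `1 ≤ t'`. -/
lemma Digit.Admissible.ocf_bounds {d : Digit} (h : d.Admissible) {t : ℝ} (ht : 1 ≤ t) :
    1 < d.1 + sgn d.2 / t ∧ d.1 + sgn d.2 / t ≤ d.1 + 1 ∧ 2 ≤ (d.1 + sgn d.2 / t) * t := by
  have h0 : 0 < t := by linarith
  have h1 : t⁻¹ ≤ 1 := inv_le_one_of_one_le₀ ht
  have h2 : 0 < t⁻¹ := by positivity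
  have h3 : t⁻¹ * t = 1 := inv_mul_cancel₀ h0.ne'
  rcases h.cases with ⟨he, ha⟩ | ⟨he, ha⟩
  · rw [he, sgn_one, div_eq_mul_inv, one_mul]
    exact ⟨by linarith, by linarith, by nlinarith⟩
  · rw [he, sgn_neg_one, div_eq_mul_inv, neg_one_mul]
    exact ⟨by linarith, by linarith, by nlinarith⟩

lemma abs_sgn_div_sub (u : ℤˣ) {s t : ℝ} (hs : 0 < s) (ht : 0 < t) :
    |sgn u / t - sgn u / s| = |t - s| / (t * s) := by
  have : sgn u / t - sgn u / s = sgn u * ((s - t) / (t * s)) := by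
    field_simp
  rw [this, abs_mul, abs_sgn, one_mul, abs_div, abs_sub_comm, abs_of_pos (mul_pos ht hs)]

/-- A single step need not contract near t = 1, but the product of two consecutive tails is at least
2, so two steps divide differences by at least 2 · 2. -/
lemma ocf_contract {d d' : Digit} (h' : d'.Admissible) {s t : ℝ} (hs : 1 ≤ s) (ht : 1 ≤ t) :
    |(d.1 + sgn d.2 / (d'.1 + sgn d'.2 / t)) - (d.1 + sgn d.2 / (d'.1 + sgn d'.2 / s))|
      ≤ |t - s| / 4 := by
  obtain ⟨t1, -, t2⟩ := h'.ocf_bounds ht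
  obtain ⟨s1, -, s2⟩ := h'.ocf_bounds hs
  rw [add_sub_add_left_eq_sub, abs_sgn_div_sub _ (by linarith) (by linarith),
    add_sub_add_left_eq_sub, abs_sgn_div_sub _ (by linarith) (by linarith), div_div]
  apply div_le_div_of_nonneg_left (abs_nonneg _) (by norm_num)
  nlinarith

/-- The tails of a sequence of digits determine each other. -/
lemma tails_unique {d : ℕ → Digit} {s t : ℕ → ℝ} (hd : ∀ n, (d n).Admissible)
    (hs1 : ∀ n, 1 ≤ s n) (ht1 : ∀ n, 1 ≤ t n)
    (hs : ∀ n, s n = (d n).1 + sgn (d n).2 / s (n + 1))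
    (ht : ∀ n, t n = (d n).1 + sgn (d n).2 / t (n + 1)) (n : ℕ) : s n = t n := by
  have key : ∀ k n, |t n - s n| ≤ 2 * (1 / 4) ^ k := by
    intro k
    induction k with
    | zero =>
      intro n
      obtain ⟨-, h2, -⟩ := (hd n).ocf_bounds (hs1 (n + 1))
      obtain ⟨-, h3, -⟩ := (hd n).ocf_bounds (ht1 (n + 1))
      rw [← hs] at h2
      rw [← ht] at h3
      have h4 : ∀ r : ℝ, 1 ≤ r → ((d n).1 : ℝ) - 1 ≤ (d n).1 + sgn (d n).2 / r := by
        intro r hr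
        have h5 : |sgn (d n).2 / r| ≤ 1 := by
          rw [abs_div, abs_sgn, abs_of_pos (by linarith)]
          exact (div_le_one (by linarith)).2 hr
        have := (abs_le.1 h5).1
        linarith
      have h5 := h4 _ (hs1 (n + 1))
      have h6 := h4 _ (ht1 (n + 1))
      rw [← hs] at h5
      rw [← ht] at h6
      rw [abs_le]
      constructor <;> linarith
    | succ k ih =>
      intro n
      rw [hs n, ht n, hs (n + 1), ht (n + 1)]
      refine (ocf_contract (hd (n + 1)) (hs1 _) (ht1 _)).trans ?_
      have := ih (n + 2)
      rw [pow_succ]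
      linarith
  have hlim : Tendsto (fun k : ℕ => (2 : ℝ) * (1 / 4) ^ k) atTop (𝓝 0) := by
    simpa using (tendsto_pow_atTop_nhds_zero_of_lt_one (r := (1 / 4 : ℝ)) (by norm_num)
      (by norm_num)).const_mul 2
  have h0 : |t n - s n| ≤ 0 := ge_of_tendsto' hlim fun k => key k n
  linarith [abs_nonpos_iff.1 h0]

/-! ### Odd continued fractions -/

lemma ocfConvergent_bounds (n : ℕ) : ∀ {d : ℕ → Digit}, (∀ n, (d n).Admissible) →
    1 ≤ ocfConvergent d n ∧ ocfConvergent d n ≤ (d 0).1 + 1 := by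
  induction n with
  | zero =>
    intro d hd
    rcases (hd 0).cases with ⟨-, h⟩ | ⟨-, h⟩ <;> simp only [ocfConvergent] <;>
      constructor <;> linarith
  | succ n ih =>
    intro d hd
    obtain ⟨h1, h2, -⟩ := (hd 0).ocf_bounds (ih (d := fun k => d (k + 1)) fun k => hd _).1
    exact ⟨h1.le, h2⟩

/-- The contraction is by 1/4 every two steps, hence the two-step induction and the rate 1/2. -/
lemma abs_ocfConvergent_sub_le (n : ℕ) : ∀ {d : ℕ → Digit} {s : ℕ → ℝ}, (∀ n, (d n).Admissible) →
    (∀ n, 1 ≤ s n) → (∀ n, s n = (d n).1 + sgn (d n).2 / s (n + 1)) →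
    |ocfConvergent d n - s 0| ≤ 2 * (1 / 2) ^ n := by
  induction n using Nat.twoStepInduction with
  | zero =>
    intro d s hd hs1 hs
    have h0 := hs1 1
    rw [ocfConvergent, hs 0, sub_add_cancel_left, abs_neg, abs_div, abs_sgn,
      abs_of_pos (by simp; linarith)]
    have : 1 / s (0 + 1) ≤ 1 := (div_le_one (by simp; linarith)).2 h0
    linarith
  | one =>
    intro d s hd hs1 hs
    have h0 := hs1 1
    have ha : (1 : ℝ) ≤ (d 1).1 := by
      rcases (hd 1).cases with ⟨-, h⟩ | ⟨-, h⟩ <;> linarith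
    have hb := (hd 1).ocf_bounds (hs1 2)
    have e1 : |((d 1).1 : ℝ) - s 1| ≤ 1 := by
      have h2 := hs1 2
      rw [hs 1, sub_add_cancel_left, abs_neg, abs_div, abs_sgn, abs_of_pos (by simp; linarith)]
      exact (div_le_one (by simp; linarith)).2 h2
    simp only [ocfConvergent]
    rw [hs 0, add_sub_add_left_eq_sub, abs_sgn_div_sub _ (by simp only [zero_add]; linarith)
      (by simp only [zero_add]; linarith)]
    rw [div_le_iff₀ (by simp only [zero_add]; nlinarith)]
    simp only [zero_add]
    nlinarith
  | more n ih _ =>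
    intro d s hd hs1 hs
    have h := ih (d := fun k => d (k + 1 + 1)) (s := fun k => s (k + 1 + 1)) (fun _ => hd _)
      (fun _ => hs1 _) (fun _ => hs _)
    simp only [ocfConvergent]
    rw [hs 0, hs (0 + 1)]
    refine (ocf_contract (hd (0 + 1)) (hs1 _)
      (ocfConvergent_bounds n (d := fun k => d (k + 1 + 1)) fun _ => hd _).1).trans ?_
    rw [pow_succ, pow_succ]
    linarith

lemma hasOCF_of_tails {d : ℕ → Digit} {s : ℕ → ℝ} (hd : ∀ n, (d n).Admissible)
    (hs1 : ∀ n, 1 ≤ s n) (hs : ∀ n, s n = (d n).1 + sgn (d n).2 / s (n + 1)) :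
    HasOCF d (s 0) := by
  refine ⟨hd, ?_⟩
  have hlim : Tendsto (fun k : ℕ => (2 : ℝ) * (1 / 2) ^ k) atTop (𝓝 0) := by
    simpa using (tendsto_pow_atTop_nhds_zero_of_lt_one (r := (1 / 2 : ℝ)) (by norm_num)
      (by norm_num)).const_mul 2
  rw [tendsto_iff_norm_sub_tendsto_zero]
  exact squeeze_zero (fun _ => norm_nonneg _) (fun n => abs_ocfConvergent_sub_le n hd hs1 hs) hlim

lemma HasOCF.one_le {d : ℕ → Digit} {x : ℝ} (h : HasOCF d x) : 1 ≤ x :=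
  ge_of_tendsto' h.2 fun n => (ocfConvergent_bounds n h.1).1

lemma HasOCF.unique {d : ℕ → Digit} {x y : ℝ} (h : HasOCF d x) (h' : HasOCF d y) : x = y :=
  tendsto_nhds_unique h.2 h'.2

lemma HasOCF.exists_tail {d : ℕ → Digit} {x : ℝ} (h : HasOCF d x) :
    ∃ x', HasOCF (fun k => d (k + 1)) x' ∧ x = (d 0).1 + sgn (d 0).2 / x' := by
  obtain ⟨hd, hx⟩ := h
  have hd' : ∀ n, ((fun k => d (k + 1)) n).Admissible := fun n => hd _
  have h1 : Tendsto (fun n => ocfConvergent d (n + 1) - (d 0).1) atTop (𝓝 (x - (d 0).1)) :=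
    ((tendsto_add_atTop_iff_nat 1).2 hx).sub_const _
  have h2 : ∀ n, ocfConvergent d (n + 1) - (d 0).1
      = sgn (d 0).2 / ocfConvergent (fun k => d (k + 1)) n := by
    intro n; simp only [ocfConvergent]; ring
  have hpos : ∀ n, 0 < ocfConvergent (fun k => d (k + 1)) n := fun n => by
    linarith [(ocfConvergent_bounds n hd').1]
  -- The tail is recovered by inverting x - a. The convergents of the tail are at most its first
  -- digit plus 1, which keeps x away from a.
  have hne : x - (d 0).1 ≠ 0 := by
    have h3 : 1 / ((d 1).1 + 1 : ℝ) ≤ |x - (d 0).1| := by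
      refine ge_of_tendsto' h1.abs fun n => ?_
      rw [h2, abs_div, abs_sgn, abs_of_pos (hpos n)]
      exact one_div_le_one_div_of_le (hpos n) (ocfConvergent_bounds n hd').2
    have h4 : (0 : ℝ) < 1 / ((d 1).1 + 1 : ℝ) := by positivity
    exact abs_pos.1 (h4.trans_le h3)
  have h5 : Tendsto (fun n => ocfConvergent (fun k => d (k + 1)) n) atTop
      (𝓝 (sgn (d 0).2 / (x - (d 0).1))) := by
    refine ((tendsto_const_nhds (x := sgn (d 0).2)).div h1 hne).congr fun n => ?_
    have := (hpos n).ne'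
    rw [Pi.div_apply, h2]
    have h6 : sgn (d 0).2 ≠ 0 := by
      intro h0; have := abs_sgn (d 0).2; rw [h0] at this; simp at this
    field_simp
  refine ⟨_, ⟨hd', h5⟩, ?_⟩
  have h6 : sgn (d 0).2 ≠ 0 := by
    intro h0; have := abs_sgn (d 0).2; rw [h0] at this; simp at this
  field_simp
  ring

lemma HasOCF.exists_tails {d : ℕ → Digit} {x : ℝ} (h : HasOCF d x) :
    ∃ s : ℕ → ℝ, (∀ n, HasOCF (fun k => d (k + n)) (s n)) ∧ s 0 = x ∧
      ∀ n, s n = (d n).1 + sgn (d n).2 / s (n + 1) := by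
  have hex : ∀ n, ∃ y, HasOCF (fun k => d (k + n)) y := by
    intro n
    induction n with
    | zero => exact ⟨x, h⟩
    | succ n ih =>
      obtain ⟨y, hy⟩ := ih
      obtain ⟨z, hz, -⟩ := hy.exists_tail
      refine ⟨z, ?_⟩
      simpa only [add_assoc, add_comm 1 n] using hz
  choose s hs using hex
  refine ⟨s, hs, (hs 0).unique h, fun n => ?_⟩
  obtain ⟨z, hz, hz'⟩ := (hs n).exists_tail
  simp only [add_assoc, add_comm 1 n] at hz
  rw [(hs (n + 1)).unique hz]
  simpa using hz'

/-! ### Grotesque continued fractions -/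

/-- -2/5 is a rational stand-in for G - 2 ≈ -0.382: the half-line above it is invariant because
-1/(3 - 2/5) = -5/13. The upper bound is 1/(1 - 2/5). -/
lemma Digit.Admissible.gcf_bounds {d : Digit} (h : d.Admissible) {u : ℝ} (hu : -(2 / 5) ≤ u) :
    3 / 5 ≤ d.1 + u ∧ -(2 / 5) ≤ sgn d.2 / (d.1 + u) ∧ sgn d.2 / (d.1 + u) ≤ 5 / 3 := by
  rcases h.cases with ⟨he, ha⟩ | ⟨he, ha⟩
  · have h1 : 3 / 5 ≤ d.1 + u := by linarith
    have h0 : 0 < d.1 + u := by linarith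
    have h2 : 0 < 1 / (d.1 + u) := by positivity
    rw [he, sgn_one]
    refine ⟨h1, by linarith, ?_⟩
    rw [div_le_iff₀ h0]; linarith
  · have h1 : 13 / 5 ≤ d.1 + u := by linarith
    have h0 : 0 < d.1 + u := by linarith
    have h2 : 0 < 1 / (d.1 + u) := by positivity
    rw [he, sgn_neg_one, neg_div]
    refine ⟨by linarith, ?_, by linarith⟩
    rw [neg_le_neg_iff, div_le_iff₀ h0]; linarith

lemma gcf_mul_bound {d d' : Digit} (h : d.Admissible) (h' : d'.Admissible) {u : ℝ}
    (hu : -(2 / 5) ≤ u) : 8 / 5 ≤ (d.1 + sgn d'.2 / (d'.1 + u)) * (d'.1 + u) := by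
  have hD := (h'.gcf_bounds hu).1
  have ha : (1 : ℝ) ≤ d.1 := by rcases h.cases with ⟨-, h⟩ | ⟨-, h⟩ <;> linarith
  rw [add_mul, div_mul_cancel₀ _ (by linarith)]
  rcases h'.cases with ⟨he, ha'⟩ | ⟨he, ha'⟩
  · rw [he, sgn_one]; nlinarith
  · rw [he, sgn_neg_one]; nlinarith

/-- Two steps divide a difference by two factors, each at least 8/5. The square 4/9 = (2/3)² exceeds
(5/8)² and gives a clean rate per step. -/
lemma gcf_contract {d d' : Digit} (h : d.Admissible) (h' : d'.Admissible) {u v : ℝ}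
    (hu : -(2 / 5) ≤ u) (hv : -(2 / 5) ≤ v) :
    |sgn d.2 / (d.1 + sgn d'.2 / (d'.1 + u)) - sgn d.2 / (d.1 + sgn d'.2 / (d'.1 + v))|
      ≤ 4 / 9 * |u - v| := by
  obtain ⟨u1, u2, -⟩ := h'.gcf_bounds hu
  obtain ⟨v1, v2, -⟩ := h'.gcf_bounds hv
  have u3 := (h.gcf_bounds u2).1
  have v3 := (h.gcf_bounds v2).1
  rw [abs_sgn_div_sub _ (by linarith) (by linarith), add_sub_add_left_eq_sub,
    abs_sgn_div_sub _ (by linarith) (by linarith), add_sub_add_left_eq_sub, div_div,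
    div_le_iff₀ (by apply mul_pos <;> apply mul_pos <;> linarith)]
  have hu' := gcf_mul_bound h h' hu
  have hv' := gcf_mul_bound h h' hv
  have : (9 : ℝ) / 4 ≤ (d'.1 + u) * (d'.1 + v) *
      ((d.1 + sgn d'.2 / (d'.1 + u)) * (d.1 + sgn d'.2 / (d'.1 + v))) := by
    nlinarith
  nlinarith [abs_nonneg (u - v)]

lemma gcfConvergent_bounds (n : ℕ) : ∀ {d : ℕ → Digit}, (∀ n, (d n).Admissible) →
    -(2 / 5) ≤ gcfConvergent d n ∧ gcfConvergent d n ≤ 5 / 3 := by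
  induction n with
  | zero =>
    intro d hd
    simpa [gcfConvergent] using ((hd 0).gcf_bounds (u := 0) (by norm_num)).2
  | succ n ih =>
    intro d hd
    exact ((hd 0).gcf_bounds (ih (d := fun k => d (k + 1)) fun k => hd _).1).2

lemma abs_gcfConvergent_sub_le (n : ℕ) : ∀ {d : ℕ → Digit} {s : ℕ → ℝ}, (∀ n, (d n).Admissible) →
    (∀ n, -(2 / 5) ≤ s n) → (∀ n, s n = sgn (d n).2 / ((d n).1 + s (n + 1))) →
    |gcfConvergent d n - s 0| ≤ 6 * (2 / 3) ^ n := by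
  have hb : ∀ (n : ℕ) {d : ℕ → Digit} {s : ℕ → ℝ}, (∀ n, (d n).Admissible) →
      (∀ n, -(2 / 5) ≤ s n) → (∀ n, s n = sgn (d n).2 / ((d n).1 + s (n + 1))) →
      |gcfConvergent d n - s 0| ≤ 4 := by
    intro n d s hd hs1 hs
    have h1 := gcfConvergent_bounds n hd
    have h2 := ((hd 0).gcf_bounds (hs1 1)).2
    rw [show s 1 = s (0 + 1) from rfl, ← hs 0] at h2
    rw [abs_le]; constructor <;> linarith
  induction n using Nat.twoStepInduction with
  | zero =>
    intro d s hd hs1 hs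
    exact (hb 0 hd hs1 hs).trans (by norm_num)
  | one =>
    intro d s hd hs1 hs
    exact (hb 1 hd hs1 hs).trans (by norm_num)
  | more n ih _ =>
    intro d s hd hs1 hs
    have h := ih (d := fun k => d (k + 1 + 1)) (s := fun k => s (k + 1 + 1)) (fun _ => hd _)
      (fun _ => hs1 _) (fun _ => hs _)
    simp only [gcfConvergent]
    rw [hs 0, hs (0 + 1)]
    refine (gcf_contract (hd 0) (hd (0 + 1))
      (gcfConvergent_bounds n (d := fun k => d (k + 1 + 1)) fun _ => hd _).1 (hs1 _)).trans ?_
    rw [pow_succ, pow_succ]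
    linarith

lemma hasGCF_of_tails {d : ℕ → Digit} {s : ℕ → ℝ} (hd : ∀ n, (d n).Admissible)
    (hs1 : ∀ n, -(2 / 5) ≤ s n) (hs : ∀ n, s n = sgn (d n).2 / ((d n).1 + s (n + 1))) :
    HasGCF d (s 0) := by
  refine ⟨hd, ?_⟩
  have hlim : Tendsto (fun k : ℕ => (6 : ℝ) * (2 / 3) ^ k) atTop (𝓝 0) := by
    simpa using (tendsto_pow_atTop_nhds_zero_of_lt_one (r := (2 / 3 : ℝ)) (by norm_num)
      (by norm_num)).const_mul 6
  rw [tendsto_iff_norm_sub_tendsto_zero]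
  exact squeeze_zero (fun _ => norm_nonneg _) (fun n => abs_gcfConvergent_sub_le n hd hs1 hs) hlim

lemma HasGCF.le {d : ℕ → Digit} {x : ℝ} (h : HasGCF d x) : -(2 / 5) ≤ x :=
  ge_of_tendsto' h.2 fun n => (gcfConvergent_bounds n h.1).1

lemma HasGCF.unique {d : ℕ → Digit} {x y : ℝ} (h : HasGCF d x) (h' : HasGCF d y) : x = y :=
  tendsto_nhds_unique h.2 h'.2

lemma HasGCF.exists_tail {d : ℕ → Digit} {x : ℝ} (h : HasGCF d x) :
    ∃ x', HasGCF (fun k => d (k + 1)) x' ∧ x = sgn (d 0).2 / ((d 0).1 + x') := by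
  obtain ⟨hd, hx⟩ := h
  have hd' : ∀ n, ((fun k => d (k + 1)) n).Admissible := fun n => hd _
  have h1 : Tendsto (fun n => gcfConvergent d (n + 1)) atTop (𝓝 x) :=
    (tendsto_add_atTop_iff_nat 1).2 hx
  have hpos : ∀ n, 0 < (d 0).1 + gcfConvergent (fun k => d (k + 1)) n := fun n => by
    linarith [((hd 0).gcf_bounds (gcfConvergent_bounds n hd').1).1]
  have hne : x ≠ 0 := by
    have h3 : 1 / ((d 0).1 + 5 / 3 : ℝ) ≤ |x| := by
      refine ge_of_tendsto' h1.abs fun n => ?_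
      simp only [gcfConvergent]
      rw [abs_div, abs_sgn, abs_of_pos (hpos n)]
      exact one_div_le_one_div_of_le (hpos n) (by linarith [(gcfConvergent_bounds n hd').2])
    have h4 : (0 : ℝ) < 1 / ((d 0).1 + 5 / 3 : ℝ) := by positivity
    exact abs_pos.1 (h4.trans_le h3)
  have h6 : sgn (d 0).2 ≠ 0 := by
    intro h0; have := abs_sgn (d 0).2; rw [h0] at this; simp at this
  have h5 : Tendsto (fun n => gcfConvergent (fun k => d (k + 1)) n) atTop
      (𝓝 (sgn (d 0).2 / x - (d 0).1)) := by
    refine (((tendsto_const_nhds (x := sgn (d 0).2)).div h1 hne).sub_const ((d 0).1 : ℝ)).congr fun n => ?_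
    have := (hpos n).ne'
    simp only [gcfConvergent, Pi.div_apply]
    field_simp
    ring
  refine ⟨_, ⟨hd', h5⟩, ?_⟩
  field_simp
  simp [h6]

lemma HasGCF.exists_tails {d : ℕ → Digit} {x : ℝ} (h : HasGCF d x) :
    ∃ s : ℕ → ℝ, (∀ n, HasGCF (fun k => d (k + n)) (s n)) ∧ s 0 = x ∧
      ∀ n, s n = sgn (d n).2 / ((d n).1 + s (n + 1)) := by
  have hex : ∀ n, ∃ y, HasGCF (fun k => d (k + n)) y := by
    intro n
    induction n with
    | zero => exact ⟨x, h⟩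
    | succ n ih =>
      obtain ⟨y, hy⟩ := ih
      obtain ⟨z, hz, -⟩ := hy.exists_tail
      refine ⟨z, ?_⟩
      simpa only [add_assoc, add_comm 1 n] using hz
  choose s hs using hex
  refine ⟨s, hs, (hs 0).unique h, fun n => ?_⟩
  obtain ⟨z, hz, hz'⟩ := (hs n).exists_tail
  simp only [add_assoc, add_comm 1 n] at hz
  rw [(hs (n + 1)).unique hz]
  simpa using hz'

/-! ### The matrices of the digits -/

/-- The matrix of `z ↦ z + 2 n`. -/
def translMat (n : ℤ) : SL(2, ℤ) := ⟨!![1, 2 * n; 0, 1], by simp⟩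

lemma coe_translMat (n : ℤ) : (translMat n : Matrix (Fin 2) (Fin 2) ℤ) = !![1, 2 * n; 0, 1] := rfl

lemma coe_matS : (matS : Matrix (Fin 2) (Fin 2) ℤ) = !![0, -1; 1, 1] := rfl

lemma matT_mem : matT ∈ Gam := Subgroup.subset_closure (by simp)

lemma matS_mem : matS ∈ Gam := Subgroup.subset_closure (by simp)

lemma translMat_mem (n : ℤ) : translMat n ∈ Gam := by
  have hmul : ∀ m n, translMat (m + n) = translMat m * translMat n := by
    intro m n
    apply Subtype.ext
    rw [Matrix.SpecialLinearGroup.coe_mul, coe_translMat, coe_translMat, coe_translMat,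
      Matrix.mul_fin_two]
    ring_nf
  have h1 : translMat 1 = matT := by
    ext i j
    fin_cases i <;> fin_cases j <;> simp [translMat, matT]
  induction n using Int.induction_on with
  | zero =>
    have : translMat 0 = 1 := by
      ext i j
      fin_cases i <;> fin_cases j <;> simp [translMat]
    rw [this]; exact one_mem _
  | succ n ih => rw [hmul, h1]; exact mul_mem ih matT_mem
  | pred n ih =>
    have : translMat (-n) = translMat (-n - 1) * matT := by rw [← h1, ← hmul, sub_add_cancel]
    rw [this] at ih
    exact (Subgroup.mul_mem_cancel_right _ matT_mem).1 ih

lemma mob_translMat (n : ℤ) (x : ℝ) : Mob (translMat n) 1 x (x + 2 * n) := by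
  simp [Mob, translMat]

/-- The matrix of `z ↦ 1 / (m - z)`. -/
def digitMat (m : ℤ) : SL(2, ℤ) := ⟨!![0, -1; 1, -m], by simp⟩

lemma coe_digitMat (m : ℤ) : (digitMat m : Matrix (Fin 2) (Fin 2) ℤ) = !![0, -1; 1, -m] := rfl

/-- 1/(m - z) = S(z - (m + 1)), and m + 1 is even; this is why Γ goes with odd digits. -/
lemma digitMat_mem {m : ℤ} (hm : Odd m) : digitMat m ∈ Gam := by
  obtain ⟨k, rfl⟩ := hm
  have : digitMat (2 * k + 1) = matS * translMat (-k - 1) := by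
    apply Subtype.ext
    rw [Matrix.SpecialLinearGroup.coe_mul, coe_translMat, coe_digitMat, coe_matS,
      Matrix.mul_fin_two]
    ring_nf
  rw [this]
  exact mul_mem matS_mem (translMat_mem _)

lemma mob_digitMat {m : ℤ} {x x' : ℝ} (h : (m - x) * x' = 1) : Mob (digitMat m) (x - m) x x' := by
  simp only [Mob, digitMat, Matrix.SpecialLinearGroup.coe_mk, Matrix.of_apply, Matrix.cons_val',
    Matrix.cons_val_zero, Matrix.cons_val_one, Matrix.cons_val_fin_one]
  push_cast
  constructor
  · linear_combination h
  · ring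

/-- `n` steps of the simultaneous expansion of both endpoints are realized by an element
of `Γ`. -/
lemma exists_mob_of_steps {d : ℕ → Digit} {ε : ℕ → ℤˣ} {α β : ℕ → ℝ} (n : ℕ)
    (hodd : ∀ i < n, Odd (d i).1) (hα1 : ∀ i ≤ n, 1 < α i)
    (hα : ∀ i < n, α i = (d i).1 + sgn (d i).2 / α (i + 1))
    (hβ0 : ∀ i < n, (d i).1 + β i ≠ 0)
    (hβ : ∀ i < n, β (i + 1) = sgn (d i).2 / ((d i).1 + β i))
    (hε : ∀ i < n, ε (i + 1) = -(d i).2 * ε i) :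
    ∃ M ∈ Gam, ∃ j m : ℝ, Mob M j (sgn (ε 0) * α 0) (sgn (ε n) * α n) ∧
      Mob M m (-(sgn (ε 0)) * β 0) (-(sgn (ε n)) * β n) ∧ |j| ≤ 1 ∧ (0 < n → |j| < 1) := by
  induction n with
  | zero => exact ⟨1, one_mem _, 1, 1, Mob.one _, Mob.one _, by simp, by simp⟩
  | succ n ih =>
    obtain ⟨M, hM, j, m, h1, h2, h3, -⟩ := ih (fun i hi => hodd i (hi.trans n.lt_succ_self))
      (fun i hi => hα1 i (hi.trans n.le_succ)) (fun i hi => hα i (hi.trans n.lt_succ_self))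
      (fun i hi => hβ0 i (hi.trans n.lt_succ_self)) (fun i hi => hβ i (hi.trans n.lt_succ_self))
      (fun i hi => hε i (hi.trans n.lt_succ_self))
    have hn := n.lt_succ_self
    have hε' := hε n hn
    have hα' := hα n hn
    have hβ' := hβ n hn
    have hβn := hβ0 n hn
    have hαn := hα1 (n + 1) le_rfl
    have hα0 : α (n + 1) ≠ 0 := by linarith
    have hcast : (((ε n : ℤ) * (d n).1 : ℤ) : ℝ) = sgn (ε n) * (d n).1 := by simp [sgn]
    have hodd' : Odd ((ε n : ℤ) * (d n).1) := by
      have h4 : Odd ((d n).1 : ℤ) := by exact_mod_cast hodd n hn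
      rcases Int.units_eq_one_or (ε n) with h | h <;> rw [h] <;> simpa using h4
    have hsε : sgn (ε (n + 1)) = -(sgn (d n).2 * sgn (ε n)) := by
      rw [hε', sgn_mul, sgn_neg, neg_mul]
    have hee := sgn_mul_self (ε n)
    have hdd := sgn_mul_self (d n).2
    -- εa - εα = -εe/α' and ε' = -eε, so the product with ε'α' is 1. The backward endpoint follows
    -- in the same way.
    have m1 : Mob (digitMat ((ε n : ℤ) * (d n).1)) (sgn (ε n) * α n - (((ε n : ℤ) * (d n).1 : ℤ) : ℝ))
        (sgn (ε n) * α n)        (sgn (ε (n + 1)) * α (n + 1)) := by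
      apply mob_digitMat
      rw [hcast, hsε, hα']
      field_simp
      linear_combination sgn (d n).2 ^ 2 * hee + hdd
    have m2 : Mob (digitMat ((ε n : ℤ) * (d n).1))
        (-(sgn (ε n)) * β n - (((ε n : ℤ) * (d n).1 : ℤ) : ℝ)) (-(sgn (ε n)) * β n)
        (-(sgn (ε (n + 1))) * β (n + 1)) := by
      apply mob_digitMat
      rw [hcast, hsε, hβ']
      field_simp
      linear_combination ((d n).1 + β n) * (sgn (d n).2 ^ 2 * hee + hdd)
    have habs : |sgn (ε n) * α n - (((ε n : ℤ) * (d n).1 : ℤ) : ℝ)| < 1 := by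
      rw [hcast, ← mul_sub, abs_mul, abs_sgn, one_mul, hα', add_sub_cancel_left, abs_div, abs_sgn,
        abs_of_pos (by linarith)]
      exact (div_lt_one (by linarith)).2 hαn
    have hj : |(sgn (ε n) * α n - (((ε n : ℤ) * (d n).1 : ℤ) : ℝ)) * j| < 1 := by
      rw [abs_mul]
      exact mul_lt_one_of_nonneg_of_lt_one_left (abs_nonneg _) habs h3
    exact ⟨_, mul_mem (digitMat_mem hodd') hM, _, _, m1.mul h1, m2.mul h2, hj.le, fun _ => hj⟩

lemma prod_signs {d : ℕ → Digit} {ε : ℕ → ℤˣ} (n : ℕ)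
    (hε : ∀ i < n, ε (i + 1) = -(d i).2 * ε i) :
    ε n = (∏ i : Fin n, (-(d i).2)) * ε 0 := by
  rw [Fin.prod_univ_eq_prod_range (fun i => -(d i).2) n]
  induction n with
  | zero => simp
  | succ n ih =>
    rw [hε n n.lt_succ_self, ih fun i hi => hε i (hi.trans n.lt_succ_self),
      Finset.prod_range_succ, mul_left_comm, mul_assoc]

/-- A geodesic on `M_o` that has a lift with purely periodic endpoints is closed. -/
lemma IsLift.isClosedGeodesic_of_hasPeriodicEndpoints {γ : ℝ → ℍ} {c : ℝ → Mo} (hγ : IsLift γ c)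
    (h : HasPeriodicEndpoints γ) : IsClosedGeodesic c := by
  obtain ⟨r, hr, w, ε, a, b, ha, hb, hx, hy, hprod⟩ := h
  obtain ⟨s, hs, hs0, hsrec⟩ := ha.exists_tails
  obtain ⟨u, hu, hu0, hurec⟩ := hb.exists_tails
  set d := periodicDigits hr w with hd
  set e : ℕ → ℤˣ := fun n => (∏ i ∈ Finset.range n, (-(d i).2)) * ε with he
  have hdw : ∀ i (hi : i < r), d i = w ⟨i, hi⟩ := by
    intro i hi
    simp only [hd, periodicDigits, Nat.mod_eq_of_lt hi]
  have hsr : s r = s 0 := by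
    refine (hs r).unique ?_
    have : (fun k => d (k + r)) = fun k => d (k + 0) := by
      funext k; simp [hd, periodicDigits]
    rw [this]; exact hs 0
  have hur : u r = u 0 := by
    refine (hu r).unique ?_
    have : (fun k => periodicDigits hr (fun i => w i.rev) (k + r)) =
        fun k => periodicDigits hr (fun i => w i.rev) (k + 0) := by
      funext k; simp [periodicDigits]
    rw [this]; exact hu 0
  have hs1 : ∀ n, 1 < s n := fun n => by
    rw [hsrec n]; exact ((ha.1 n).ocf_bounds (hs (n + 1)).one_le).1
  have hrev : ∀ i < r, periodicDigits hr (fun i => w i.rev) (r - (i + 1)) = d i := by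
    intro i hi
    have h1 : r - (i + 1) < r := by omega
    rw [hdw i hi]
    simp only [periodicDigits, Nat.mod_eq_of_lt h1]
    congr 1
    ext
    simp only [Fin.val_rev]
    omega
  have hu1 : ∀ i < r, 0 < (d i).1 + u (r - i) := by
    intro i hi
    linarith [((ha.1 i).gcf_bounds (hu (r - i)).le).1]
  have her : e r = e 0 := by
    have h1 : ∏ i ∈ Finset.range r, (-(d i).2) = 1 := by
      rw [← Fin.prod_univ_eq_prod_range (fun i => -(d i).2) r, ← hprod]
      exact Finset.prod_congr rfl fun i _ => by rw [hdw i i.2]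
    simp [he, h1]
  -- Each forward step prepends a digit to the backward expansion, so its tails are run through in
  -- reverse: βᵢ is the tail of index r - i.
  obtain ⟨M, hM, j, m, h1, h2, -, h3⟩ := exists_mob_of_steps (d := d) (ε := e) (α := s)
    (β := fun i => u (r - i)) r (fun i _ => (ha.1 i).1) (fun i _ => hs1 i) (fun i _ => hsrec i)
    (fun i hi => (hu1 i hi).ne') (fun i hi => by
      have h4 : r - (i + 1) + 1 = r - i := by omega
      rw [hurec (r - (i + 1)), hrev i hi, h4])
    (fun i _ => by simp only [he, Finset.prod_range_succ]; rw [mul_left_comm, mul_assoc])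
  have he0 : e 0 = ε := by simp [he]
  rw [her, he0, hsr, hs0] at h1
  simp only [her, he0, Nat.sub_self, Nat.sub_zero, hur, hu0] at h2
  exact hγ.isClosedGeodesic hx hy hM h1 h2 (h3 hr)

/-! ### Fixed points of hyperbolic elements -/

/-- A rational fixed point has a rational eigenvalue, a root of the monic integral polynomial λ² -
tr(P) λ + 1, and this must be ±1. -/
lemma irrational_of_mob {P : SL(2, ℤ)} {l x : ℝ} (h : Mob P l x x) (hl : l ^ 2 ≠ 1) :
    Irrational x := by
  rintro ⟨q, rfl⟩
  have hdet := det_cast P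
  obtain ⟨h1, h2⟩ := h
  set L : ℚ := P 1 0 * q + P 1 1 with hL
  have hlL : l = (L : ℝ) := by rw [← h2, hL]; push_cast; ring
  have hchar : l ^ 2 - ((P 0 0 : ℝ) + P 1 1) * l + 1 = 0 := by
    linear_combination (l - P 0 0) * (-h2) - (P 1 0 : ℝ) * h1 - hdet
  have hcharQ : L ^ 2 - ((P 0 0 : ℚ) + P 1 1) * L + 1 = 0 := by
    rw [hlL] at hchar; exact_mod_cast hchar
  have hnd : L * L.den = L.num := Rat.mul_den_eq_num L
  have hint : L.num ^ 2 + (L.den : ℤ) ^ 2 = (P 0 0 + P 1 1) * L.num * L.den := by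
    have : (L.num : ℚ) ^ 2 + (L.den : ℚ) ^ 2 = ((P 0 0 : ℚ) + P 1 1) * L.num * L.den := by
      rw [← hnd]; linear_combination (L.den : ℚ) ^ 2 * hcharQ
    exact_mod_cast this
  have hco : IsCoprime L.num (L.den : ℤ) := by
    rw [Int.isCoprime_iff_nat_coprime]; exact L.reduced
  have hn : IsUnit L.num := by
    refine (hco.pow_right (n := 2)).isUnit_of_dvd' dvd_rfl ?_
    exact ⟨(P 0 0 + P 1 1) * L.den - L.num, by linear_combination hint⟩
  have hd : IsUnit (L.den : ℤ) := by
    refine (hco.pow_left (m := 2)).isUnit_of_dvd' ?_ dvd_rfl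
    exact ⟨(P 0 0 + P 1 1) * L.num - L.den, by linear_combination hint⟩
  have hn2 : (L.num : ℚ) ^ 2 = 1 := by
    rcases Int.isUnit_iff.1 hn with h | h <;> rw [h] <;> norm_num
  have hd2 : (L.den : ℚ) ^ 2 = 1 := by
    have : (L.den : ℤ) ^ 2 = 1 := by
      rcases Int.isUnit_iff.1 hd with h | h <;> rw [h] <;> norm_num
    exact_mod_cast this
  have hL2 : L ^ 2 = 1 := by
    have : (L * L.den) ^ 2 = 1 := by rw [hnd, hn2]
    rwa [mul_pow, hd2, mul_one] at this
  apply hl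
  rw [hlL]
  exact_mod_cast hL2

lemma finite_bounded (B : ℝ) : {P : SL(2, ℤ) | ∀ i j, |(P i j : ℝ)| ≤ B}.Finite := by
  have h1 : (Set.pi univ fun _ : Fin 2 => Set.pi univ fun _ : Fin 2 =>
      Icc (-⌊B⌋) ⌊B⌋).Finite :=
    Set.Finite.pi fun _ => Set.Finite.pi fun _ => Set.finite_Icc _ _
  refine (h1.preimage (f := fun P : SL(2, ℤ) => fun i j => P i j) ?_).subset ?_
  · intro P _ Q _ hPQ
    ext i j
    exact congrFun (congrFun hPQ i) j
  · intro P hP i _ j _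
    change P i j ∈ Icc (-⌊B⌋) ⌊B⌋
    rw [mem_Icc, ← abs_le, Int.le_floor]
    exact_mod_cast hP i j

lemma mob_sub {P : SL(2, ℤ)} {l m x y : ℝ} (hx : Mob P l x x) (hy : Mob P m y y) :
    (P 1 0 : ℝ) * (x - y) = l - m := by
  linear_combination hx.2 - hy.2

/-- An integral matrix with given eigenvalues is bounded in terms of its fixed points. -/
lemma bounded_of_mob {P : SL(2, ℤ)} {l m x y : ℝ} (hx : Mob P l x x) (hy : Mob P m y y)
    (hxy : 1 / 2 ≤ |x - y|) (hy2 : |y| ≤ 2) (i j : Fin 2) :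
    |(P i j : ℝ)| ≤ 2 * (|l| + |m| + 4 * |l - m|) := by
  have hne : x - y ≠ 0 := by
    intro h; rw [h] at hxy; norm_num at hxy
  have h10 := mob_sub hx hy
  have k10 : |(P 1 0 : ℝ)| ≤ 2 * |l - m| := by
    rw [← h10, abs_mul]; nlinarith [abs_nonneg (P 1 0 : ℝ)]
  have k10y : |(P 1 0 : ℝ) * y| ≤ 4 * |l - m| := by
    rw [abs_mul]; nlinarith [abs_nonneg (P 1 0 : ℝ), abs_nonneg y]
  have h11 : (P 1 1 : ℝ) = m - P 1 0 * y := by linear_combination hy.2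
  have h00 : (P 0 0 : ℝ) = l + P 1 0 * y := by
    apply mul_right_cancel₀ hne
    linear_combination hx.1 - hy.1 - y * h10
  have h01 : (P 0 1 : ℝ) = (m - P 0 0) * y := by linear_combination hy.1
  have k11 : |(P 1 1 : ℝ)| ≤ |m| + 4 * |l - m| := by
    rw [h11]; exact (abs_sub _ _).trans (by linarith)
  have k00 : |(P 0 0 : ℝ)| ≤ |l| + 4 * |l - m| := by
    rw [h00]; exact (abs_add_le _ _).trans (by linarith)
  have k01 : |(P 0 1 : ℝ)| ≤ 2 * (|l| + |m| + 4 * |l - m|) := by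
    have h5 : |m - P 0 0| ≤ |m| + |(P 0 0 : ℝ)| := abs_sub _ _
    rw [h01, abs_mul]
    nlinarith [abs_nonneg (m - P 0 0 : ℝ), abs_nonneg y]
  have a1 := abs_nonneg l
  have a2 := abs_nonneg m
  have a3 := abs_nonneg (l - m)
  fin_cases i <;> fin_cases j
  · exact k00.trans (by linarith)
  · exact k01
  · exact k10.trans (by linarith)
  · exact k11.trans (by linarith)

/-! ### The expansion of irrational numbers -/

/-- The digit is the odd integer nearest to x, and the sign tells on which side x lies. If it is 1,
then x > 1 forces the sign +, as admissibility requires. -/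
lemma exists_digit {x : ℝ} (hx1 : 1 < x) (hx : Irrational x) :
    ∃ (d : Digit) (x' : ℝ), d.Admissible ∧ 1 < x' ∧ Irrational x' ∧ x = d.1 + sgn d.2 / x' := by
  set k := ⌊x / 2⌋₊ with hk
  have hk1 : (k : ℝ) ≤ x / 2 := Nat.floor_le (by linarith)
  have hk2 : x / 2 < k + 1 := Nat.lt_floor_add_one _
  have hlow : ((2 * k : ℕ) : ℝ) ≠ x := (hx.ne_nat _).symm
  have hmid : ((2 * k + 1 : ℕ) : ℝ) ≠ x := (hx.ne_nat _).symm
  have hirr : Irrational (x - (2 * k + 1 : ℕ)) := hx.sub_natCast _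
  push_cast at hlow hmid hirr
  have hlow' : 2 * (k : ℝ) < x := lt_of_le_of_ne (by linarith) hlow
  rcases lt_or_gt_of_ne hmid with h | h
  · refine ⟨(2 * k + 1, 1), (x - (2 * k + 1))⁻¹, ⟨odd_two_mul_add_one k, ?_⟩, ?_, hirr.inv, ?_⟩
    · simp; omega
    · exact one_lt_inv_iff₀.2 ⟨by linarith, by linarith⟩
    · simp [sgn_one]
  · have hirr' := hirr.neg
    rw [neg_sub] at hirr'
    refine ⟨(2 * k + 1, -1), (2 * k + 1 - x)⁻¹, ⟨odd_two_mul_add_one k, ?_⟩, ?_, hirr'.inv, ?_⟩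
    · have : 0 < k := by
        rcases Nat.eq_zero_or_pos k with h0 | h0
        · rw [h0] at h; push_cast at h; linarith
        · exact h0
      simp; omega
    · exact one_lt_inv_iff₀.2 ⟨by linarith, by linarith⟩
    · simp [sgn_neg_one]

lemma exists_expansion {x : ℝ} (hx1 : 1 < x) (hx : Irrational x) :
    ∃ (d : ℕ → Digit) (α : ℕ → ℝ), α 0 = x ∧ (∀ n, (d n).Admissible) ∧ (∀ n, 1 < α n) ∧
      ∀ n, α n = (d n).1 + sgn (d n).2 / α (n + 1) := by
  choose f g h1 h2 h3 h4 using fun p : {x : ℝ // 1 < x ∧ Irrational x} =>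
    exists_digit p.2.1 p.2.2
  let s : ℕ → {x : ℝ // 1 < x ∧ Irrational x} := fun n =>
    Nat.rec ⟨x, hx1, hx⟩ (fun _ p => ⟨g p, h2 p, h3 p⟩) n
  exact ⟨fun n => f (s n), fun n => (s n).1, rfl, fun n => h1 _, fun n => (s n).2.1,
    fun n => h4 (s n)⟩

/-! ### The dynamics of the backward endpoint -/

lemma golden_lt : Real.goldenRatio < 1.7 := by
  have h := Real.goldenRatio_sq
  nlinarith [Real.one_lt_goldenRatio]

lemma lt_golden : 1.6 < Real.goldenRatio := by
  have h := Real.goldenRatio_sq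
  nlinarith [Real.one_lt_goldenRatio]

lemma Digit.Admissible.neg_half_lt {d : Digit} (h : d.Admissible) {u : ℝ} (hu : -1 < u) :
    -(1 / 2) < sgn d.2 / (d.1 + u) := by
  rcases h.cases with ⟨he, ha⟩ | ⟨he, ha⟩
  · have h0 : 0 < d.1 + u := by linarith
    have h2 : 0 < 1 / (d.1 + u) := by positivity
    rw [he, sgn_one]; linarith
  · have h0 : 0 < d.1 + u := by linarith
    rw [he, sgn_neg_one, neg_div, neg_lt_neg_iff, div_lt_iff₀ h0]; linarith

/-- The extreme cases at u = G - 2 return the endpoints of I_G: 1/(1 + u) = G for the digit (1, 1)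
and -1/(3 + u) = G - 2 for (3, -1). -/
lemma Digit.Admissible.mem_IG {d : Digit} (h : d.Admissible) {u : ℝ} (hu : u ∈ IG) :
    sgn d.2 / (d.1 + u) ∈ IG := by
  have hG := Real.goldenRatio_sq
  have g1 := golden_lt
  have g2 := lt_golden
  obtain ⟨u1, u2⟩ := hu
  rcases h.cases with ⟨he, ha⟩ | ⟨he, ha⟩
  · have h0 : 0 < d.1 + u := by linarith
    have h2 : 0 < 1 / (d.1 + u) := by positivity
    rw [he, sgn_one]
    refine ⟨by linarith, ?_⟩
    rw [div_lt_iff₀ h0]; nlinarith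
  · have h0 : 0 < d.1 + u := by linarith
    have h2 : 0 < 1 / (d.1 + u) := by positivity
    rw [he, sgn_neg_one, neg_div]
    refine ⟨?_, by linarith⟩
    rw [lt_neg, div_lt_iff₀ h0]; nlinarith

/-- Unless the digit is `(3, -1)`, a backward endpoint that exceeds `-1/2` enters `I_G` within
two steps. -/
lemma mem_IG_or_mem_IG {d d' : Digit} (h : d.Admissible) (h' : d'.Admissible)
    (hd : d ≠ (3, -1)) {u : ℝ} (hu : -(1 / 2) < u) :
    sgn d.2 / (d.1 + u) ∈ IG ∨ sgn d'.2 / (d'.1 + sgn d.2 / (d.1 + u)) ∈ IG := by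
  have g1 := golden_lt
  have g2 := lt_golden
  rcases h.cases with ⟨he, ha⟩ | ⟨he, ha⟩
  · have h0 : 0 < d.1 + u := by linarith
    have h2 : 0 < 1 / (d.1 + u) := by positivity
    rw [he, sgn_one]
    rcases lt_or_ge (1 / (d.1 + u)) Real.goldenRatio with h3 | h3
    -- A value at or beyond G is large and positive, so the next step, whatever its digit, lands in
    -- I_G.
    · exact Or.inl ⟨by linarith, h3⟩
    · right
      set v := 1 / (d.1 + u) with hv
      rcases h'.cases with ⟨he', ha'⟩ | ⟨he', ha'⟩
      · have h4 : 0 < d'.1 + v := by linarith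
        have h5 : 0 < 1 / (d'.1 + v) := by positivity
        rw [he', sgn_one]
        refine ⟨by linarith, ?_⟩
        rw [div_lt_iff₀ h4]; nlinarith
      · have h4 : 0 < d'.1 + v := by linarith
        have h5 : 0 < 1 / (d'.1 + v) := by positivity
        rw [he', sgn_neg_one, neg_div]
        refine ⟨?_, by linarith⟩
        rw [lt_neg, div_lt_iff₀ h4]; nlinarith
  · left
    have ha5 : (5 : ℝ) ≤ d.1 := by
      have h3 : 3 ≤ d.1 := by exact_mod_cast ha
      have h4 : d.1 ≠ 3 := fun h4 => hd (Prod.ext h4 he)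
      obtain ⟨k, hk⟩ := h.1
      have : 5 ≤ d.1 := by omega
      exact_mod_cast this
    have h0 : 0 < d.1 + u := by linarith
    have h2 : 0 < 1 / (d.1 + u) := by positivity
    rw [he, sgn_neg_one, neg_div]
    refine ⟨?_, by linarith⟩
    rw [lt_neg, div_lt_iff₀ h0]; nlinarith

lemma irrational_digit_step {u : ℝ} (hu : Irrational u) (d : Digit) :
    Irrational (sgn d.2 / (d.1 + u)) := by
  have h1 : Irrational ((d.1 + u)⁻¹) := (hu.natCast_add _).inv
  rcases Int.units_eq_one_or d.2 with h | h
  · rw [h, sgn_one, one_div]; exact h1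
  · rw [h, sgn_neg_one, neg_div, one_div]; exact h1.neg

lemma three_neg_one_admissible : Digit.Admissible (3, -1) :=
  ⟨by decide, by norm_num⟩

lemma golden_sq_tail : Real.goldenRatio ^ 2 = 3 + -1 / Real.goldenRatio ^ 2 := by
  have hG := Real.goldenRatio_sq
  have h0 : Real.goldenRatio ≠ 0 := Real.goldenRatio_ne_zero
  rw [← sub_eq_iff_eq_add', eq_div_iff (pow_ne_zero 2 h0)]
  linear_combination (Real.goldenRatio ^ 2 + Real.goldenRatio - 1) * hG

/-- A periodic pair of expansions gives purely periodic endpoints. -/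
lemma hasPeriodicEndpoints_of_return {γ : ℝ → ℍ} {d : ℕ → Digit} {ε : ℕ → ℤˣ} {α β : ℕ → ℝ}
    {r : ℕ} (hr : 0 < r) (hd : ∀ i, (d i).Admissible) (hα1 : ∀ i, 1 ≤ α i)
    (hα : ∀ i, α i = (d i).1 + sgn (d i).2 / α (i + 1))
    (hβ1 : ∀ i, -(2 / 5) ≤ β i)
    (hβ : ∀ i, β (i + 1) = sgn (d i).2 / ((d i).1 + β i))
    (hε : ∀ i, ε (i + 1) = -(d i).2 * ε i)
    (hαr : α r = α 0) (hβr : β r = β 0) (hεr : ε r = ε 0)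
    (hx : ForwardEndpoint γ (sgn (ε 0) * α 0)) (hy : BackwardEndpoint γ (-(sgn (ε 0)) * β 0)) :
    HasPeriodicEndpoints γ := by
  have hstep : ∀ n, (n + 1) % r = n % r + 1 ∨ (n % r + 1 = r ∧ (n + 1) % r = 0) := by
    intro n
    have hlt := Nat.mod_lt n hr
    have h1 : (n + 1) % r = (n % r + 1) % r := by simp
    rcases Nat.lt_or_ge (n % r + 1) r with h | h
    · left; rw [h1, Nat.mod_eq_of_lt h]
    · right
      have h2 : n % r + 1 = r := by omega
      exact ⟨h2, by rw [h1, h2, Nat.mod_self]⟩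
  refine ⟨r, hr, fun i => d i, ε 0, α 0, β 0, ?_, ?_, hx, hy, ?_⟩
  · have := hasOCF_of_tails (d := periodicDigits hr fun i => d i) (s := fun n => α (n % r))
      (fun n => hd _) (fun n => hα1 _) (fun n => by
        simp only [periodicDigits]
        rcases hstep n with h | ⟨h, h'⟩
        · rw [h]; exact hα _
        · have h2 := hα (n % r)
          rw [h, hαr] at h2
          rw [h']
          exact h2)
    simpa using this
  -- Index 0 uses β r rather than β 0; the two agree by `hβr`, which closes the cycle.
  · have := hasGCF_of_tails (d := periodicDigits hr fun i => d i.rev)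
      (s := fun n => β (r - n % r)) (fun n => hd _) (fun n => hβ1 _) (fun n => by
        simp only [periodicDigits, Fin.val_rev]
        have hlt := Nat.mod_lt n hr
        have e1 : r - n % r = r - (n % r + 1) + 1 := by omega
        rw [e1, hβ]
        rcases hstep n with h | ⟨h, h'⟩
        · rw [h]
        · rw [h', h, Nat.sub_zero, Nat.sub_self, hβr])
    simpa [hβr] using this
  · have h1 := prod_signs (d := d) (ε := ε) r fun i _ => hε i
    rw [hεr] at h1
    exact mul_eq_right.1 h1.symm

/-- The geodesic `(-G², G - 2)` is equivalent to `(G², 2 - G)`. -/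
lemma exists_mob_golden : ∃ M ∈ Gam, ∃ j m : ℝ,
    Mob M j (-Real.goldenRatio ^ 2) (Real.goldenRatio ^ 2) ∧
      Mob M m (Real.goldenRatio - 2) (2 - Real.goldenRatio) := by
  have hG := Real.goldenRatio_sq
  refine ⟨matT * (matS⁻¹ * matT), mul_mem matT_mem (mul_mem (inv_mem matS_mem) matT_mem),
    ?_⟩
  have e : ∀ i j, (matT * (matS⁻¹ * matT)) i j = !![-1, -1; -1, -2] i j := by
    intro i j
    fin_cases i <;> fin_cases j <;> decide
  refine ⟨Real.goldenRatio ^ 2 - 2, -Real.goldenRatio, ⟨?_, ?_⟩, ⟨?_, ?_⟩⟩ <;>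
    simp only [e, Matrix.of_apply, Matrix.cons_val', Matrix.cons_val_zero, Matrix.cons_val_one,
      Matrix.cons_val_fin_one] <;> push_cast
  · linear_combination (-Real.goldenRatio ^ 2 - Real.goldenRatio + 1) * hG
  · ring
  · linear_combination -hG
  · ring

/-- The endpoint conjugate to `± G²`. -/
lemma conj_of_golden {P : SL(2, ℤ)} {l m α β : ℝ} {ε : ℤˣ} (hα : α = Real.goldenRatio ^ 2)
    (hx : Mob P l (sgn ε * α) (sgn ε * α)) (hy : Mob P m (-(sgn ε) * β) (-(sgn ε) * β))
    (hne : sgn ε * α ≠ -(sgn ε) * β) (hlm : l ≠ m) : β = Real.goldenRatio - 2 := by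
  have hG := Real.goldenRatio_sq
  set s := sgn ε with hs
  have hss : s * s = 1 := sgn_mul_self ε
  set x := s * α with hxdef
  set y := -s * β with hydef
  have hxy : x - y ≠ 0 := sub_ne_zero.2 hne
  have h10 : (P 1 0 : ℝ) ≠ 0 := by
    intro h0
    have := mob_sub hx hy
    rw [h0, zero_mul] at this
    exact hlm (by linarith)
  have hxq : x ^ 2 = 3 * s * x - 1 := by
    rw [hxdef, hα, mul_pow, pow_two s, hss]
    linear_combination (3 * Real.goldenRatio ^ 2) * (-hss) + (Real.goldenRatio ^ 2 + Real.goldenRatio - 1) * hG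
  have hquad : ∀ z n, Mob P n z z →
      (P 1 0 : ℝ) * z ^ 2 + ((P 1 1 : ℝ) - P 0 0) * z - P 0 1 = 0 := by
    intro z n hz
    linear_combination z * hz.2 - hz.1
  have hqx := hquad x l hx
  have hqy := hquad y m hy
  have hsZ : s = ((ε : ℤ) : ℝ) := rfl
  have hirr : Irrational x := by
    have h1 : Irrational (Real.goldenRatio ^ 2) := by
      rw [hG]; exact_mod_cast Real.goldenRatio_irrational.add_natCast 1
    rw [hxdef, hα]
    rcases Int.units_eq_one_or ε with h | h
    · rw [hs, h, sgn_one, one_mul]; exact h1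
    · rw [hs, h, sgn_neg_one, neg_one_mul]; exact h1.neg
  -- The fixed point equation of P and x² - 3sx + 1 = 0 share the irrational root x. Eliminating x²
  -- gives an integral linear relation, so its coefficient of x is 0 and Vieta yields x + y = 3s.
  have hlin : ((3 * (ε : ℤ) * P 1 0 + P 1 1 - P 0 0 : ℤ) : ℝ) * x = ((P 1 0 + P 0 1 : ℤ) : ℝ) := by
    push_cast
    rw [← hsZ]
    linear_combination hqx - (P 1 0 : ℝ) * hxq
  have hzero : (3 * (ε : ℤ) * P 1 0 + P 1 1 - P 0 0 : ℤ) = 0 := by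
    by_contra h0
    exact (hirr.intCast_mul h0).ne_int _ hlin
  have hsum : (P 1 0 : ℝ) * (x + y) + ((P 1 1 : ℝ) - P 0 0) = 0 := by
    apply mul_right_cancel₀ hxy
    linear_combination hqx - hqy
  have hzero' : 3 * s * (P 1 0 : ℝ) + P 1 1 - P 0 0 = 0 := by
    rw [hsZ]; exact_mod_cast hzero
  have hfin : x + y = 3 * s := by
    apply mul_left_cancel₀ h10
    linear_combination hsum - hzero'
  have h5 : s * (α - β) = s * 3 := by linear_combination hfin
  have hs0 : s ≠ 0 := left_ne_zero_of_mul_eq_one hss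
  have := mul_left_cancel₀ hs0 h5
  linarith

/-! ### Reduction of closed geodesics -/

/-- Backward endpoints are eventually larger than `-1/2`. -/
lemma exists_neg_half_lt {d : ℕ → Digit} {α β : ℕ → ℝ} (hd : ∀ n, (d n).Admissible)
    (hα1 : ∀ n, 1 < α n) (hα : ∀ n, α n = (d n).1 + sgn (d n).2 / α (n + 1))
    (hβ : ∀ n, β (n + 1) = sgn (d n).2 / ((d n).1 + β n))
    (hβ0 : ∀ n, (d n).1 + β n ≠ 0) (hne : α 0 ≠ -β 0) :
    ∃ N, ∀ n ≥ N, -(1 / 2) < β n := by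
  -- If every -β n were at least 1, these numbers would be tails for the same digits as α, and
  -- uniqueness of tails would give equal endpoints.
  have h1 : ∃ n, -1 < β n := by
    by_contra! h
    refine hne (tails_unique (t := fun n => -β n) hd (fun n => (hα1 n).le)
      (fun n => by linarith [h n]) hα (fun n => ?_) 0)
    have h0 := hβ0 n
    have hs := sgn_mul_self (d n).2
    have hs0 : sgn (d n).2 ≠ 0 := left_ne_zero_of_mul_eq_one hs
    simp only [hβ n]
    field_simp
    ring
  obtain ⟨n, hn⟩ := h1
  refine ⟨n + 1, fun m hm => ?_⟩
  induction m, hm using Nat.le_induction with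
  | base => rw [hβ]; exact (hd n).neg_half_lt hn
  | succ m _ ih => rw [hβ]; exact (hd m).neg_half_lt (by linarith)

/-- Either the backward endpoints eventually lie in `I_G`, or all digits are eventually
`(3, -1)`. -/
lemma eventually_mem_IG_or {d : ℕ → Digit} {β : ℕ → ℝ} (hd : ∀ n, (d n).Admissible)
    (hβ : ∀ n, β (n + 1) = sgn (d n).2 / ((d n).1 + β n)) {N : ℕ}
    (hN : ∀ n ≥ N, -(1 / 2) < β n) :
    (∃ n, ∀ m ≥ n, β m ∈ IG) ∨ ∀ n ≥ N, d n = (3, -1) := by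
  by_cases h : ∃ n, β n ∈ IG
  · left
    obtain ⟨n, hn⟩ := h
    refine ⟨n, fun m hm => ?_⟩
    induction m, hm using Nat.le_induction with
    | base => exact hn
    | succ m _ ih => rw [hβ]; exact (hd m).mem_IG ih
  · right
    intro n hn
    by_contra h3
    rcases mem_IG_or_mem_IG (hd n) (hd (n + 1)) h3 (hN n hn) with h1 | h1
    · rw [← hβ] at h1; exact h ⟨_, h1⟩
    · rw [← hβ, ← hβ] at h1; exact h ⟨_, h1⟩

/-- A closed geodesic has a lift in `A_o`, or the exceptional lift, with purely periodic
endpoints. -/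
lemma IsClosedGeodesic.exists_lift {c : ℝ → Mo} (hc : IsClosedGeodesic c) :
    ∃ γ : ℝ → ℍ, IsLift γ c ∧
      (γ ∈ Ao ∨ (ForwardEndpoint γ (Real.goldenRatio ^ 2) ∧
        BackwardEndpoint γ (2 - Real.goldenRatio))) ∧ HasPeriodicEndpoints γ := by
  obtain ⟨γ, P, l, x, y, hγ, -, hl, hx, hy, hPx, hPy, hxy⟩ := hc.exists_fixed
  have hl0 := hPx.ne_zero
  have hll : l ≠ l⁻¹ := by
    intro h
    apply hl
    rw [pow_two]; nth_rw 2 [h]; exact mul_inv_cancel₀ hl0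
  have hl' : l⁻¹ ^ 2 ≠ 1 := by rwa [inv_pow, Ne, inv_eq_one]
  have hxirr := irrational_of_mob hPx hl
  have hyirr := irrational_of_mob hPy hl'
  obtain ⟨k, hk⟩ := exists_int_gt ((1 - x) / 2)
  have hx0 : 1 < x + 2 * k := by linarith
  have hx0irr : Irrational (x + 2 * k) := by
    have := hxirr.add_intCast (2 * k); push_cast at this; exact this
  have hy0irr : Irrational (-(y + 2 * k)) := by
    have := (hyirr.add_intCast (2 * k)).neg; push_cast at this; exact this
  obtain ⟨d, α, hα0, hd, hα1, hα⟩ := exists_expansion hx0 hx0irr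
  obtain ⟨β, hβ0, hβ⟩ : ∃ β : ℕ → ℝ, β 0 = -(y + 2 * k) ∧
      ∀ n, β (n + 1) = sgn (d n).2 / ((d n).1 + β n) :=
    ⟨fun n => Nat.rec (-(y + 2 * k)) (fun n b => sgn (d n).2 / ((d n).1 + b)) n, rfl,
      fun n => rfl⟩
  obtain ⟨ε, hε0, hε⟩ : ∃ ε : ℕ → ℤˣ, ε 0 = 1 ∧ ∀ n, ε (n + 1) = -(d n).2 * ε n :=
    ⟨fun n => Nat.rec 1 (fun n e => -(d n).2 * e) n, rfl, fun n => rfl⟩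
  have hβirr : ∀ n, Irrational (β n) := by
    intro n
    induction n with
    | zero => rw [hβ0]; exact hy0irr
    | succ n ih => rw [hβ]; exact irrational_digit_step ih _
  have hβne : ∀ n, (d n).1 + β n ≠ 0 := fun n => ((hβirr n).natCast_add _).ne_zero
  have hmob : ∀ n, ∃ M ∈ Gam, ∃ j m : ℝ, Mob M j x (sgn (ε n) * α n) ∧
      Mob M m y (-(sgn (ε n)) * β n) := by
    intro n
    obtain ⟨M, hM, j, m, h1, h2, -, -⟩ := exists_mob_of_steps (d := d) (ε := ε) (α := α) (β := β) n
      (fun i _ => (hd i).1) (fun i _ => hα1 i) (fun i _ => hα i) (fun i _ => hβne i)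
      (fun i _ => hβ i) (fun i _ => hε i)
    rw [hε0, sgn_one, one_mul, hα0] at h1
    rw [hε0, sgn_one, neg_one_mul, hβ0, neg_neg] at h2
    exact ⟨_, mul_mem hM (translMat_mem k), _, _, h1.mul (mob_translMat k x),
      h2.mul (mob_translMat k y)⟩
  choose M hM j m hMx hMy using hmob
  have hQx := fun n => hPx.conj (hMx n)
  have hQy := fun n => hPy.conj (hMy n)
  have hlift := fun n => hγ.smul (hM n)
  have hfwd : ∀ n, ForwardEndpoint (fun t => M n • γ t) (sgn (ε n) * α n) := fun n =>
    tendsto_smul_of_mob hx (hMx n)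
  have hbwd : ∀ n, BackwardEndpoint (fun t => M n • γ t) (-(sgn (ε n)) * β n) := fun n =>
    tendsto_smul_of_mob hy (hMy n)
  obtain ⟨N, hN⟩ := exists_neg_half_lt hd hα1 hα hβ hβne (by
    rw [hα0, hβ0, neg_neg]; intro h; exact hxy (add_right_cancel h))
  have g1 := golden_lt
  have g2 := lt_golden
  have hns : ∀ n, sgn (ε n) * α n ≠ -(sgn (ε n)) * β n := by
    intro n h
    have h1 := mob_sub (hQx n) (hQy n)
    rw [h, sub_self, mul_zero] at h1
    exact hll (by linarith)
  rcases eventually_mem_IG_or hd hβ hN with ⟨n₀, hIG⟩ | hspecial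
  · have hmaps : ∀ n : ℕ, (M (n₀ + n) * P * (M (n₀ + n))⁻¹) ∈
        {Q : SL(2, ℤ) | ∀ i j, |(Q i j : ℝ)| ≤ 2 * (|l| + |l⁻¹| + 4 * |l - l⁻¹|)} := by
      intro n
      obtain ⟨b1, b2⟩ := hIG (n₀ + n) (Nat.le_add_right _ _)
      have ha := hα1 (n₀ + n)
      refine bounded_of_mob (hQx (n₀ + n)) (hQy (n₀ + n)) ?_ ?_
      · have : sgn (ε (n₀ + n)) * α (n₀ + n) - -(sgn (ε (n₀ + n))) * β (n₀ + n) =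
            sgn (ε (n₀ + n)) * (α (n₀ + n) + β (n₀ + n)) := by ring
        rw [this, abs_mul, abs_sgn, one_mul]
        exact le_trans (by linarith) (le_abs_self _)
      · rw [abs_mul, abs_neg, abs_sgn, one_mul, abs_le]
        constructor <;> linarith
    obtain ⟨p, -, q, -, hpq, hQeq⟩ := infinite_univ.exists_lt_map_eq_of_mapsTo
      (f := fun n : ℕ => M (n₀ + n) * P * (M (n₀ + n))⁻¹) (fun n _ => hmaps n)
      (finite_bounded _)
    have hQx' := hQx (n₀ + q)
    have hQy' := hQy (n₀ + q)
    rw [← hQeq] at hQx' hQy'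
    have h10 : ((M (n₀ + p) * P * (M (n₀ + p))⁻¹) 1 0 : ℝ) ≠ 0 := by
      intro h0
      have h1 := mob_sub (hQx (n₀ + p)) (hQy (n₀ + p))
      rw [h0, zero_mul] at h1
      exact hll (by linarith)
    -- The common matrix Q and the eigenvalue l determine the fixed point through Q₁₀ x + Q₁₁ = l.
    have hxeq : sgn (ε (n₀ + p)) * α (n₀ + p) = sgn (ε (n₀ + q)) * α (n₀ + q) := by
      apply mul_left_cancel₀ h10
      linear_combination (hQx (n₀ + p)).2 - hQx'.2
    have hyeq : -(sgn (ε (n₀ + p))) * β (n₀ + p) = -(sgn (ε (n₀ + q))) * β (n₀ + q) := by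
      apply mul_left_cancel₀ h10
      linear_combination (hQy (n₀ + p)).2 - hQy'.2
    have ap := hα1 (n₀ + p)
    have aq := hα1 (n₀ + q)
    -- α > 1 makes the sign visible in the endpoint; this equality gives the sign condition on the
    -- period.
    have hεeq : ε (n₀ + p) = ε (n₀ + q) := by
      rcases Int.units_eq_one_or (ε (n₀ + p)) with h1 | h1 <;>
        rcases Int.units_eq_one_or (ε (n₀ + q)) with h2 | h2 <;>
        simp only [h1, h2, sgn_one, sgn_neg_one] at hxeq ⊢ <;> linarith
    rw [hεeq] at hxeq hyeq
    have hs0 : sgn (ε (n₀ + q)) ≠ 0 := left_ne_zero_of_mul_eq_one (sgn_mul_self _)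
    have hαeq := mul_left_cancel₀ hs0 hxeq
    have hβeq := mul_left_cancel₀ (neg_ne_zero.2 hs0) hyeq
    have hidx : n₀ + p + (q - p) = n₀ + q := by omega
    refine ⟨_, hlift (n₀ + p), Or.inl ⟨(hlift (n₀ + p)).1, _, _, hfwd _, hbwd _, ?_⟩, ?_⟩
    · have hb := hIG (n₀ + p) (Nat.le_add_right _ _)
      rcases Int.units_eq_one_or (ε (n₀ + p)) with h1 | h1
      · left
        rw [h1, sgn_one]
        exact ⟨by simpa using ap, by simpa using hb⟩
      · right
        rw [h1, sgn_neg_one]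
        exact ⟨by simpa using ap, by simpa using hb⟩
    · refine hasPeriodicEndpoints_of_return (d := fun i => d (n₀ + p + i))
        (ε := fun i => ε (n₀ + p + i)) (α := fun i => α (n₀ + p + i))
        (β := fun i => β (n₀ + p + i)) (r := q - p) (by omega) (fun i => hd _)
        (fun i => (hα1 _).le) (fun i => hα _) (fun i => ?_) (fun i => hβ _) (fun i => hε _)
        (by simp only [hidx, add_zero, hαeq]) (by simp only [hidx, add_zero, hβeq])
        (by simp only [hidx, add_zero, hεeq]) (hfwd _) (hbwd _)
      have := (hIG (n₀ + p + i) (by omega)).1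
      linarith
  · have hαN : α N = Real.goldenRatio ^ 2 := by
      refine tails_unique (d := fun _ => (3, -1)) (s := fun n => α (N + n))
        (t := fun _ => Real.goldenRatio ^ 2) (fun _ => three_neg_one_admissible)
        (fun n => (hα1 _).le) (fun _ => by nlinarith) (fun n => ?_) (fun n => ?_) 0
      · have := hα (N + n)
        rw [hspecial (N + n) (Nat.le_add_right _ _)] at this
        exact this
      · simpa [sgn_neg_one] using golden_sq_tail
    have hβN : β N = Real.goldenRatio - 2 :=
      conj_of_golden hαN (hQx N) (hQy N) (hns N) hll
    obtain ⟨δ, hδ, hδx, hδy⟩ : ∃ δ : ℝ → ℍ, IsLift δ c ∧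
        ForwardEndpoint δ (Real.goldenRatio ^ 2) ∧ BackwardEndpoint δ (2 - Real.goldenRatio) := by
      have hf := hfwd N
      have hb := hbwd N
      rw [hαN] at hf
      rw [hβN] at hb
      rcases Int.units_eq_one_or (ε N) with h1 | h1
      · rw [h1, sgn_one, one_mul] at hf
        rw [h1, sgn_one, neg_one_mul, neg_sub] at hb
        exact ⟨_, hlift N, hf, hb⟩
      · rw [h1, sgn_neg_one, neg_one_mul] at hf
        rw [h1, sgn_neg_one, neg_neg, one_mul] at hb
        -- The digit (3, -1) leaves ε unchanged, so further steps never turn ε = -1 into 1; a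
        -- separate element of Γ does it.
        obtain ⟨R, hR, u, v, hRx, hRy⟩ := exists_mob_golden
        exact ⟨_, (hlift N).smul hR, tendsto_smul_of_mob hf hRx, tendsto_smul_of_mob hb hRy⟩
    refine ⟨δ, hδ, Or.inr ⟨hδx, hδy⟩, ?_⟩
    have hG := Real.goldenRatio_sq
    refine hasPeriodicEndpoints_of_return (d := fun _ => (3, -1)) (ε := fun _ => 1)
      (α := fun _ => Real.goldenRatio ^ 2) (β := fun _ => Real.goldenRatio - 2) one_pos
      (fun _ => three_neg_one_admissible) (fun _ => by nlinarith)
      (fun _ => by simpa [sgn_neg_one] using golden_sq_tail) (fun _ => by linarith)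
      (fun _ => ?_) (fun _ => by simp) rfl rfl rfl (by simpa [sgn_one] using hδx)
      (by simpa [sgn_one] using hδy)
    rw [sgn_neg_one, eq_div_iff (by push_cast; linarith)]
    push_cast
    linear_combination hG

end OddCF

theorem mainTheorem5 (c : ℝ → OddCF.Mo) (hc : OddCF.IsGeodesicMo c) :
    OddCF.IsClosedGeodesic c ↔
      ∃ γ : ℝ → UpperHalfPlane, OddCF.IsLift γ c ∧
        (γ ∈ OddCF.Ao ∨
          (OddCF.ForwardEndpoint γ (Real.goldenRatio ^ 2) ∧
            OddCF.BackwardEndpoint γ (2 - Real.goldenRatio))) ∧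
        OddCF.HasPeriodicEndpoints γ := by
  constructor
  · exact fun h => h.exists_lift
  · rintro ⟨γ, hγ, -, h⟩
    exact hγ.isClosedGeodesic_of_hasPeriodicEndpoints h
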